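/- Let $n\ge 2$ and $\mathbb K\in\{\mathbb R,\mathbb C\}$; put $\alpha=\frac12$ if $\mathbb K=\mathbb R$ and $\alpha=\frac1{\sqrt\pi}$ if $\mathbb K=\mathbb C$. Let $B=\{x\in\mathbb K^n : \max_k|x_k|\le\alpha\}$ be the cube (polydisc) of volume $1$, with boundary $\partial B$, and let $a^\perp=\{x\in\mathbb K^n:\langle x,a\rangle=0\}$. Let $a=(a_1,\dots,a_n)\in\mathbb R^n$ with $\sum_k a_k^2=1$. The perimeter of the section of the cube by $a^\perp$ is defined as follows. If $\mathbb K=\mathbb R$, then $P_{n-2}(a)=\mathrm{vol}_{n-2}(\partial B\cap a^\perp)$ (for $n=2$, the number of points). If $\mathbb K=\mathbb C$, then $P_{2(n-2)}(a)$ is the $2(n-2)$-dimensional volume of the sections of $\partial B\cap a^\perp$ on which a coordinate is a fixed point of the boundary circle, integrated over the angle of that point: $$P_{2(n-2)}(a)=\int_0^{2\pi}\sum_{k=1}^n \mathrm{vol}_{2(n-2)}\Big\{x\in\partial B\cap a^\perp : x_k=\tfrac1{\sqrt\pi}e^{i\theta},\ |x_j|<\tfrac1{\sqrt\pi}\text{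 for all } j<k\Big\}\,d\theta ,$$ where the condition on $j<k$ only ensures that a point with several coordinates on the boundary circle is counted once. Then both perimeters are finite and $$P_{n-2}(a)=2\sum_{k=1}^n\sqrt{1-a_k^2}\;\frac2\pi\int_0^\infty\prod_{j\ne k}\frac{\sin(a_js)}{a_js}\,\cos(a_ks)\,ds\qquad(\mathbb K=\mathbb R),$$ $$P_{2(n-2)}(a)=2\pi\sum_{k=1}^n(1-a_k^2)\;\frac12\int_0^\infty\prod_{j\ne k}j_1(a_js)\,J_0(a_ks)\,s\,ds\qquad(\mathbb K=\mathbb C).$$ Here $J_\nu$ is the Bessel function of the first kind of index $\nu$, $j_1(t)=2J_1(t)/t$, and $\frac{\sin(a_js)}{a_js}$ and $j_1(a_js)$ are read as $1$ if $a_j=0$. The integrals are improper integrals $\lim_{R\to\infty}\int_0^R$, which converge for every $k$ with $|a_k|\ne1$; a term with $|a_k|=1$, whose weight is $0$, is read as $0$. -/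

import Mathlib

open Filter Topology MeasureTheory

noncomputable section

/-- The cube (polydisc for `𝕜 = ℂ`) `{x ∈ 𝕜ⁿ : ‖x‖_∞ ≤ α}`, inside Euclidean `𝕜ⁿ`. -/
def cubeOfRadius (𝕜 : Type*) [RCLike 𝕜] (n : ℕ) (α : ℝ) : Set (EuclideanSpace 𝕜 (Fin n)) :=
  {x | ∀ k, ‖x k‖ ≤ α}

/-- `∂B ∩ a^⊥`, where `B` is the cube of radius `α`. -/
def boundarySection {𝕜 : Type*} [RCLike 𝕜] {n : ℕ} (α : ℝ) (a : EuclideanSpace 𝕜 (Fin n)) :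
    Set (EuclideanSpace 𝕜 (Fin n)) :=
  frontier (cubeOfRadius 𝕜 n α) ∩ ((Submodule.span 𝕜 {a})ᗮ : Set (EuclideanSpace 𝕜 (Fin n)))

/-- Real case: the `(n-2)`-dimensional volume of `∂B ∩ a^⊥`, where `B = [-1/2, 1/2]ⁿ`. Volume is
the Hausdorff measure normalized to agree with Lebesgue measure on Euclidean space. -/
def realPerimeter {n : ℕ} (a : EuclideanSpace ℝ (Fin n)) : ENNReal :=
  μHE[n - 2] (boundarySection (1 / 2) a)

/-- The radius `1/√π` of the disc of area `1`. -/
def discRadius : ℝ := 1 / Real.sqrt Real.pi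

/-- The part of a set `S` in the boundary of the polydisc on which the `k`-th coordinate is the
boundary point of angle `θ` of its disc; a point of `S` several of whose coordinates lie on the
boundary circle is attributed to the first of them, so that no part of `S` counts twice. -/
def angularFace {n : ℕ} (S : Set (EuclideanSpace ℂ (Fin n))) (k : Fin n) (θ : ℝ) :
    Set (EuclideanSpace ℂ (Fin n)) :=
  {x ∈ S | x k = discRadius * Complex.exp (θ * Complex.I) ∧ ∀ j < k, ‖x j‖ ≠ discRadius}

/-- Complex case: `∂B ∩ a^⊥` (`B` the polydisc of volume `1`) is fibred over the angle `θ` of the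
boundary coordinate into sets of real dimension `2(n-2)`. The perimeter is the
`2(n-2)`-dimensional volume of these sets, integrated over `θ`. (For `𝕜 = ℝ` the same recipe, with
the sum over the two boundary points `±1/2` of the interval in place of the integral over `θ`,
gives `realPerimeter`.) -/
def complexPerimeter {n : ℕ} (a : EuclideanSpace ℂ (Fin n)) : ENNReal :=
  ∫⁻ θ in Set.Ioc 0 (2 * Real.pi),
    ∑ k, μHE[2 * (n - 2)] (angularFace (boundarySection discRadius a) k θ)

/-- The Bessel function of the first kind `J_ν` of integer index `ν ≥ 0`. -/
def besselJ (ν : ℕ) (t : ℝ) : ℝ :=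
  ∑' m : ℕ, (-1) ^ m / ((m.factorial : ℝ) * ((m + ν).factorial : ℝ)) * (t / 2) ^ (2 * m + ν)

/-- `j_1(t) = 2 J_1(t) / t`, with value `1` at `t = 0`. -/
def jOne (t : ℝ) : ℝ := if t = 0 then 1 else 2 * besselJ 1 t / t

/-- `I` is the improper Riemann integral of `f` over `[0, ∞)`. -/
def HasImproperIntegral (f : ℝ → ℝ) (I : ℝ) : Prop :=
  (∀ R : ℝ, IntervalIntegrable f volume 0 R) ∧
    Tendsto (fun R : ℝ => ∫ s in (0 : ℝ)..R, f s) atTop (𝓝 I)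

/-- The inclusion `ℝⁿ ⊂ ℂⁿ`. -/
def toComplexVector {n : ℕ} (a : EuclideanSpace ℝ (Fin n)) : EuclideanSpace ℂ (Fin n) :=
  WithLp.toLp 2 (fun k => (a k : ℂ))

end

/-! Let `E` be ℝ or ℂ as a real inner product space, of dimension d, and fix a face, that is, an
index k and a value u of x_k with ‖u‖ = α. If |a_k| ≠ 1, some a_m with m ≠ k is nonzero, and the
section of the face by the hyperplane is a graph over the n - 2 remaining coordinates z: the
relation determines x_m, and ‖x_m‖ ≤ α becomes the slab condition ‖Y‖ ≤ |a_m| α for Y = a_k u + ∑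
a_j z_j. A Gram determinant gives the Jacobian (√(1 - a_k²)/|a_m|)^d, so the volume of the section
is this factor times the measure of the slab in a product of n - 2 balls (`measure_faceSection`).

The oscillatory integral computes the same measure. `Real.sinc` and `jOne` are the characteristic
functions, up to scaling, of the interval and the disc of measure 1. Hence all factors except the
m-th form the mean of cos(2s‖Y‖) in the real case, and of J₀(s‖Y‖/α) in the complex case.
Integrating against the m-th factor (times s if `E` is ℂ) over [0, R] gives a kernel that is bounded
uniformly and tends to a multiple of the indicator of ‖Y‖ ≤ |a_m| α, with value 1/2 at the jump
(`tendsto_integral_sinc_mul_cos`, `tendsto_integral_jOne_mul_besselJ_zero`). Dominated convergence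
then yields the improper integral (`hasImproperIntegral_of_kernel`).

The value 1/2 concerns the points at which x_m lies on the boundary as well. They form a null set
unless a_k and a_m have equal absolute value and all other coefficients vanish. In that case the
sections of the k-th and the m-th face agree up to sign, and the two halves add up to one section,
which is what attributing a point to its first boundary coordinate counts
(`sum_measure_firstFaceSection`). Finally, applying one isometry of `E` to all coordinates shows
that the volumes do not depend on the choice of u; this produces the factors 2 and 2π. -/

section PiLpVolume

/-! ### Volume on ℓ² products. -/

variable {ι E : Type*} [Fintype ι] [NormedAddCommGroup E] [InnerProductSpace ℝ E]
  [FiniteDimensional ℝ E] [MeasurableSpace E] [BorelSpace E]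

/-- The `ℓ²` product of finite-dimensional inner product spaces carries the product volume. -/
theorem PiLp.measurePreserving_toLp_pi :
    MeasurePreserving (@WithLp.toLp 2 (ι → E)) volume
      (volume : Measure (PiLp 2 (fun _ : ι => E))) := by
  classical
  let e : (ι → E) ≃L[ℝ] PiLp 2 (fun _ : ι => E) := (PiLp.continuousLinearEquiv 2 ℝ _).symm
  have he : (e : (ι → E) → PiLp 2 (fun _ : ι => E)) = @WithLp.toLp 2 (ι → E) := rfl
  refine ⟨he ▸ e.continuous.measurable, ?_⟩
  have hH : ((volume : Measure (ι → E)).map e).IsAddHaarMeasure :=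
    ContinuousLinearEquiv.isAddHaarMeasure_map e volume
  rw [he] at hH
  have h1 := Measure.isAddLeftInvariant_eq_smul
    ((volume : Measure (ι → E)).map (@WithLp.toLp 2 (ι → E)))
    (volume : Measure (PiLp 2 (fun _ : ι => E)))
  -- Haar measure is unique up to a factor. The factor is read off on the parallelepiped of an
  -- orthonormal basis of the product, which is a product of unit parallelepipeds.
  let b := stdOrthonormalBasis ℝ E
  let B := Pi.orthonormalBasis (fun _ : ι => b)
  have hB : volume (parallelepiped B) = 1 := B.volume_parallelepiped
  have hpre : (@WithLp.toLp 2 (ι → E)) ⁻¹' (parallelepiped B)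
      = Set.pi Set.univ (fun _ => parallelepiped b) := by
    ext x
    have e1 := parallelepiped_basis_eq B.toBasis
    have e2 := parallelepiped_basis_eq b.toBasis
    simp only [OrthonormalBasis.coe_toBasis] at e1 e2
    rw [e1, e2]
    simp only [Set.mem_preimage, Set.mem_ofPred_eq, Set.mem_pi, Set.mem_univ, forall_true_left,
      OrthonormalBasis.coe_toBasis_repr_apply]
    constructor
    · intro h i j
      exact h ⟨i, j⟩
    · rintro h ⟨i, j⟩
      exact h i j
  have h2 := congrArg (fun μ => μ (parallelepiped B)) h1
  have hm : MeasurableSet (parallelepiped B) := by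
    have := (B.toBasis.parallelepiped).isCompact.measurableSet
    simpa using this
  simp only [Measure.smul_apply, hB] at h2
  rw [Measure.map_apply (he ▸ e.continuous.measurable) hm, hpre, volume_pi_pi] at h2
  have hb : volume (parallelepiped b) = 1 := b.volume_parallelepiped
  simp only [hb, Finset.prod_const_one, ENNReal.smul_def, smul_eq_mul, mul_one] at h2
  have h3 : Measure.addHaarScalarFactor
    ((volume : Measure (ι → E)).map (@WithLp.toLp 2 (ι → E)))
    (volume : Measure (PiLp 2 (fun _ : ι => E))) = 1 := by exact_mod_cast h2.symm
  rw [h1, h3, one_smul]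

end PiLpVolume

/-- The determinant of the identity plus a rank one matrix. -/
theorem Matrix.det_one_add_vecMulVec_self {κ : Type*} [Fintype κ] [DecidableEq κ] (u : κ → ℝ) :
    (1 + Matrix.of fun i j => u i * u j).det = 1 + ∑ i, u i ^ 2 := by
  have h := Matrix.det_one_add_replicateCol_mul_replicateRow (ι := Unit) u u
  have h2 : Matrix.replicateCol Unit u * Matrix.replicateRow Unit u =
      Matrix.of fun i j => u i * u j := by
    ext i j; simp [Matrix.mul_apply]
  rw [h2] at h
  rw [h]
  simp [dotProduct, sq]

/-! ### Sections of faces as graphs, and their Jacobian. -/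

section Graph

variable {ι E : Type*} [Fintype ι] [DecidableEq ι] [NormedAddCommGroup E] [InnerProductSpace ℝ E]

/-- The remaining coordinates after two of them have been singled out. -/
abbrev Others (k m : ι) : Type _ := {j : ι // j ≠ k ∧ j ≠ m}

theorem sum_eq_add_add_sum_others {M : Type*} [AddCommMonoid M] {k m : ι} (hkm : k ≠ m)
    (f : ι → M) : ∑ i, f i = f k + f m + ∑ j : Others k m, f j := by
  classical
  rw [← Finset.add_sum_erase _ _ (Finset.mem_univ k),
    ← Finset.add_sum_erase _ _ (Finset.mem_erase.2 ⟨hkm.symm, Finset.mem_univ m⟩), add_assoc]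
  congr 2
  refine Finset.sum_subtype _ (fun x => ?_) f
  simp [and_comm]

theorem prod_erase_eq_mul_prod_others {M : Type*} [CommMonoid M] {k m : ι} (hkm : k ≠ m)
    (f : ι → M) : ∏ i ∈ Finset.univ.erase k, f i = f m * ∏ j : Others k m, f j := by
  classical
  rw [← Finset.mul_prod_erase _ _ (Finset.mem_erase.2 ⟨hkm.symm, Finset.mem_univ m⟩)]
  congr 1
  refine Finset.prod_subtype _ (fun x => ?_) f
  simp [and_comm]

theorem card_others {k m : ι} (hkm : k ≠ m) :
    Fintype.card (Others k m) = Fintype.card ι - 2 := by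
  have h := sum_eq_add_add_sum_others hkm (fun _ => 1)
  simp only [Finset.sum_const, Finset.card_univ, smul_eq_mul, mul_one] at h
  omega

/-- The point of the hyperplane `∑ j, a j • x j = 0` whose `k`-th coordinate is `u`, and whose
coordinates other than the `k`-th and the `m`-th are `z`. -/
noncomputable def hyperplanePoint (a : ι → ℝ) (k m : ι) (u : E) (z : Others k m → E) : PiLp 2 (fun _ : ι => E) :=
  WithLp.toLp 2 fun i =>
    if h : i ≠ k ∧ i ≠ m then z ⟨i, h⟩
    else if i = k then u else -(a m)⁻¹ • (a k • u + ∑ j : Others k m, a j • z j)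

variable {a : ι → ℝ} {k m : ι}

theorem hyperplanePoint_fst (u : E) (z : Others k m → E) :
    hyperplanePoint a k m u z k = u := by
  simp [hyperplanePoint]

theorem hyperplanePoint_snd (hkm : k ≠ m) (u : E) (z : Others k m → E) :
    hyperplanePoint a k m u z m = -(a m)⁻¹ • (a k • u + ∑ j : Others k m, a j • z j) := by
  simp [hyperplanePoint, hkm.symm]

theorem hyperplanePoint_others (u : E) (z : Others k m → E) (j : Others k m) :
    hyperplanePoint a k m u z j = z j := by
  simp [hyperplanePoint, j.2]

theorem sum_hyperplanePoint (hkm : k ≠ m) (ham : a m ≠ 0) (u : E) (z : Others k m → E) :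
    ∑ i, a i • hyperplanePoint a k m u z i = 0 := by
  rw [sum_eq_add_add_sum_others hkm, hyperplanePoint_fst, hyperplanePoint_snd hkm]
  simp_rw [hyperplanePoint_others]
  rw [smul_smul, mul_neg, mul_inv_cancel₀ ham]
  module

theorem eq_hyperplanePoint (hkm : k ≠ m) (ham : a m ≠ 0) {x : PiLp 2 (fun _ : ι => E)}
    (hx : ∑ i, a i • x i = 0) :
    hyperplanePoint a k m (x k) (fun j => x j) = x := by
  ext i
  by_cases hk : i = k
  · subst hk; rw [hyperplanePoint_fst]
  by_cases hm : i = m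
  · subst hm
    rw [hyperplanePoint_snd hkm]
    rw [sum_eq_add_add_sum_others hkm] at hx
    have : a k • x k + ∑ j : Others k i, a j • x j = - (a i • x i) := by
      rw [eq_neg_iff_add_eq_zero, ← hx]; abel
    rw [this, smul_neg, neg_smul, neg_neg, smul_smul, inv_mul_cancel₀ ham, one_smul]
  · exact hyperplanePoint_others (x k) (fun j => x j) ⟨i, hk, hm⟩

/-- The linear part of `hyperplanePoint`. -/
noncomputable def hyperplaneLinear (E : Type*) [NormedAddCommGroup E] [InnerProductSpace ℝ E]
    (a : ι → ℝ) (k m : ι) :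
    PiLp 2 (fun _ : Others k m => E) →ₗ[ℝ] PiLp 2 (fun _ : ι => E) where
  toFun z := hyperplanePoint a k m 0 z
  map_add' z w := by
    ext i
    simp only [hyperplanePoint, PiLp.add_apply, smul_add, Finset.sum_add_distrib, smul_zero,
      zero_add]
    split_ifs <;> simp
  map_smul' c z := by
    ext i
    simp only [hyperplanePoint, PiLp.smul_apply, smul_zero, zero_add, RingHom.id_apply,
      smul_comm (_ : ℝ) c, ← Finset.smul_sum]
    split_ifs <;> simp

theorem hyperplanePoint_eq_add (u : E) (z : Others k m → E) :
    hyperplanePoint a k m u z =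
      hyperplaneLinear E a k m (WithLp.toLp 2 z) + hyperplanePoint a k m u 0 := by
  ext i
  simp only [hyperplaneLinear, LinearMap.coe_mk, AddHom.coe_mk, hyperplanePoint, PiLp.add_apply,
    smul_zero, zero_add, Pi.zero_apply, Finset.sum_const_zero, add_zero, smul_add]
  split_ifs <;> simp [add_comm]

/-- The linear part has k-th entry 0 and copies `z`, so only the m-th entry, a weighted sum of the
`z j`, adds to the inner product. This rank one correction makes the Gram determinant computable. -/
theorem inner_hyperplaneLinear (hkm : k ≠ m) (z w : PiLp 2 (fun _ : Others k m => E)) :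
    inner ℝ (hyperplaneLinear E a k m z) (hyperplaneLinear E a k m w) =
      inner ℝ z w + inner ℝ (∑ j : Others k m, (a j / a m) • z j) (∑ j : Others k m, (a j / a m) • w j) := by
  rw [PiLp.inner_apply, sum_eq_add_add_sum_others hkm]
  simp only [hyperplaneLinear, LinearMap.coe_mk, AddHom.coe_mk, hyperplanePoint_fst,
    hyperplanePoint_snd hkm, hyperplanePoint_others, inner_zero_left, zero_add, smul_zero, neg_smul,
    inner_neg_neg]
  rw [add_comm, PiLp.inner_apply]
  simp only [div_eq_inv_mul, ← smul_smul, ← Finset.smul_sum]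

variable [FiniteDimensional ℝ E]

/-- In an orthonormal basis the Gram matrix is (1 + v vᵀ) ⊗ 1 with v_j = a_j / a_m. Its determinant
is a power of 1 + ‖v‖², which equals (1 - a_k²) / a_m² because `a` is a unit vector. -/
theorem normDet_hyperplaneLinear (hkm : k ≠ m) (ham : a m ≠ 0) (ha : ∑ i, a i ^ 2 = 1) :
    (hyperplaneLinear E a k m).normDet =
      (Real.sqrt (1 - a k ^ 2) / |a m|) ^ Module.finrank ℝ E := by
  have hsum : 1 + ∑ j : Others k m, (a j / a m) ^ 2 = (Real.sqrt (1 - a k ^ 2) / |a m|) ^ 2 := by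
    rw [sum_eq_add_add_sum_others hkm] at ha
    have h0 : 0 ≤ ∑ j : Others k m, a j ^ 2 := Finset.sum_nonneg fun _ _ => sq_nonneg _
    rw [div_pow, Real.sq_sqrt (by nlinarith [sq_nonneg (a m)]), sq_abs]
    simp_rw [div_pow]
    rw [← Finset.sum_div]
    field_simp
    linarith
  let b := stdOrthonormalBasis ℝ E
  let B := (Pi.orthonormalBasis (fun _ : Others k m => b)).reindex (Equiv.sigmaEquivProd _ _)
  have hg := LinearMap.normDet_sq_eq_det_gram (hyperplaneLinear E a k m) B
  have hgram : Matrix.gram ℝ (fun i => hyperplaneLinear E a k m (B i)) =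
      Matrix.kronecker (1 + Matrix.of fun i j : Others k m => (a i / a m) * (a j / a m))
        (1 : Matrix (Fin (Module.finrank ℝ E)) (Fin (Module.finrank ℝ E)) ℝ) := by
    ext ⟨i, p⟩ ⟨j, q⟩
    have hS : ∀ (i : Others k m) (p), ∑ l : Others k m, (a l / a m) • (B (i, p)) l = (a i / a m) • b p := by
      intro i p
      rw [Finset.sum_eq_single i]
      · simp [B]
      · intro l _ hl; simp [B, hl]
      · simp
    rw [Matrix.gram_apply, inner_hyperplaneLinear hkm, hS, hS, inner_smul_left, inner_smul_right,
      orthonormal_iff_ite.1 B.orthonormal, orthonormal_iff_ite.1 b.orthonormal]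
    simp only [Matrix.kronecker, Matrix.kroneckerMap_apply, Matrix.add_apply, Matrix.one_apply,
      Matrix.of_apply, Prod.mk.injEq]
    by_cases h1 : i = j <;> by_cases h2 : p = q <;> simp [h1, h2]
  rw [hgram] at hg
  rw [Matrix.kronecker, Matrix.det_kronecker, Matrix.det_one_add_vecMulVec_self, Matrix.det_one,
    one_pow, mul_one, hsum, Fintype.card_fin] at hg
  simp only [RCLike.ofReal_real_eq_id, id_eq] at hg
  rw [← pow_mul, mul_comm 2, pow_mul] at hg
  exact (sq_eq_sq₀ (LinearMap.normDet_nonneg _) (by positivity)).1 hg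

variable [MeasurableSpace E] [BorelSpace E]

/-- The volume of a part of the section of a face by a hyperplane, in terms of its coordinate
projection. -/
theorem euclideanHausdorffMeasure_face_section (hkm : k ≠ m) (ham : a m ≠ 0)
    (ha : ∑ i, a i ^ 2 = 1) (u : E) (T : Set (PiLp 2 (fun _ : ι => E))) :
    μHE[Module.finrank ℝ E * (Fintype.card ι - 2)]
        {x | x ∈ T ∧ x k = u ∧ ∑ i, a i • x i = 0} =
      ENNReal.ofReal ((Real.sqrt (1 - a k ^ 2) / |a m|) ^ Module.finrank ℝ E) *
        volume {z : Others k m → E | hyperplanePoint a k m u z ∈ T} := by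
  have hset : {x | x ∈ T ∧ x k = u ∧ ∑ i, a i • x i = 0} =
      (fun x => x + hyperplanePoint a k m u (0 : Others k m → E)) ''
        (hyperplaneLinear E a k m '' {z | hyperplanePoint a k m u z ∈ T}) := by
    ext x
    simp only [Set.mem_ofPred_eq, Set.mem_image, exists_exists_and_eq_and]
    constructor
    · rintro ⟨hxT, hxk, hx⟩
      refine ⟨WithLp.toLp 2 fun j => x j, ?_, ?_⟩
      · have := eq_hyperplanePoint hkm ham hx
        rw [hxk] at this
        simpa [this] using hxT
      · rw [← hyperplanePoint_eq_add, ← hxk, eq_hyperplanePoint hkm ham hx]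
    · rintro ⟨z, hz, rfl⟩
      have := hyperplanePoint_eq_add (a := a) u z.ofLp
      rw [WithLp.toLp_ofLp] at this
      rw [← this]
      exact ⟨hz, hyperplanePoint_fst _ _, sum_hyperplanePoint hkm ham _ _⟩
  have hdim : Module.finrank ℝ E * (Fintype.card ι - 2) =
      Module.finrank ℝ (PiLp 2 (fun _ : Others k m => E)) := by
    rw [← card_others hkm, (WithLp.linearEquiv 2 ℝ (Others k m → E)).finrank_eq,
      Module.finrank_pi_fintype]
    simp [mul_comm]
  -- The translation is an isometry and the linear map scales volume by `normDet`. What remains is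
  -- to replace the ℓ² volume by the product volume.
  rw [hset, Isometry.euclideanHausdorffMeasure_image (isometry_add_right _), hdim,
    LinearMap.euclideanHausdorffMeasure_image_eq_normDet_mul_volume,
    normDet_hyperplaneLinear hkm ham ha]
  congr 1
  let e := (PiLp.continuousLinearEquiv 2 ℝ (fun _ : Others k m => E)).symm.toHomeomorph.toMeasurableEquiv
  have he : MeasurePreserving e volume volume := PiLp.measurePreserving_toLp_pi
  rw [← he.measure_preimage_equiv]
  rfl

end Graph

/-! ### The Bessel functions J₀ and J₁. -/

section Bessel

/-- The `m`-th term of the power series of `J_ν`. -/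
noncomputable def besselTerm (ν m : ℕ) (t : ℝ) : ℝ :=
  (-1) ^ m / ((m.factorial : ℝ) * ((m + ν).factorial : ℝ)) * (t / 2) ^ (2 * m + ν)

theorem continuous_besselTerm (ν m : ℕ) : Continuous (besselTerm ν m) := by
  unfold besselTerm; fun_prop

/-- Dropping the second factorial leaves an exponential series. This locally uniform bound justifies
both continuity and termwise integration. -/
theorem abs_besselTerm_le (ν m : ℕ) {t M : ℝ} (h : |t| ≤ M) :
    |besselTerm ν m t| ≤ (M / 2) ^ ν * (((M / 2) ^ 2) ^ m / (m.factorial : ℝ)) := by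
  have hM : 0 ≤ M := (abs_nonneg t).trans h
  have h1 : |t / 2| ≤ M / 2 := by rw [abs_div, abs_two]; linarith
  have h2 : |t / 2| ^ (2 * m + ν) ≤ (M / 2) ^ (2 * m + ν) := by gcongr
  have hf : (1 : ℝ) ≤ ((m + ν).factorial : ℝ) := by exact_mod_cast Nat.factorial_pos _
  have hf0 : (0 : ℝ) < (m.factorial : ℝ) := by exact_mod_cast Nat.factorial_pos _
  rw [besselTerm, abs_mul, abs_div, abs_pow, abs_neg, abs_one, one_pow, abs_pow,
    abs_of_pos (by positivity : (0 : ℝ) < (m.factorial : ℝ) * ((m + ν).factorial : ℝ))]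
  calc 1 / ((m.factorial : ℝ) * ((m + ν).factorial : ℝ)) * |t / 2| ^ (2 * m + ν)
      ≤ 1 / ((m.factorial : ℝ) * 1) * (M / 2) ^ (2 * m + ν) := by gcongr
    _ = _ := by rw [mul_one, pow_add, pow_mul]; ring

theorem summable_besselTerm_bound (ν : ℕ) (M : ℝ) :
    Summable fun m : ℕ => (M / 2) ^ ν * (((M / 2) ^ 2) ^ m / (m.factorial : ℝ)) :=
  (Real.summable_pow_div_factorial _).mul_left _

theorem hasSum_besselTerm (ν : ℕ) (t : ℝ) : HasSum (fun m => besselTerm ν m t) (besselJ ν t) :=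
  (Summable.of_norm_bounded (summable_besselTerm_bound ν |t|)
    fun m => abs_besselTerm_le ν m le_rfl).hasSum

theorem continuous_besselJ (ν : ℕ) : Continuous (besselJ ν) := by
  refine continuous_iff_continuousAt.2 fun x => ?_
  have : ContinuousOn (fun t => ∑' m, besselTerm ν m t) (Metric.ball 0 (|x| + 1)) :=
    continuousOn_tsum (fun m => (continuous_besselTerm ν m).continuousOn)
      (summable_besselTerm_bound ν (|x| + 1)) fun m t ht => abs_besselTerm_le ν m (by
        rw [mem_ball_zero_iff, Real.norm_eq_abs] at ht; exact ht.le)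
  exact this.continuousAt (Metric.isOpen_ball.mem_nhds (by simp))

/-- Termwise integration of a Bessel series multiplied by a continuous weight. -/
theorem hasSum_integral_mul_besselTerm (ν : ℕ) {g : ℝ → ℝ} (hg : Continuous g) (a b : ℝ) :
    HasSum (fun m => ∫ t in a..b, g t * besselTerm ν m t) (∫ t in a..b, g t * besselJ ν t) := by
  obtain ⟨C, hC⟩ := (isCompact_uIcc (a := a) (b := b)).exists_bound_of_continuousOn
    hg.continuousOn
  refine intervalIntegral.hasSum_integral_of_dominated_convergence
    (fun m _ => C * ((max |a| |b| / 2) ^ ν * (((max |a| |b| / 2) ^ 2) ^ m / (m.factorial : ℝ))))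
    (fun m => (hg.mul (continuous_besselTerm ν m)).aestronglyMeasurable) ?_ ?_ ?_ ?_
  · refine fun m => Eventually.of_forall fun t ht => ?_
    rw [norm_mul]
    have h1 := hC t (Set.uIoc_subset_uIcc ht)
    have ht' := Set.uIoc_subset_uIcc ht
    have h2 : |t| ≤ max |a| |b| := by
      rw [Set.mem_uIcc] at ht'
      rcases ht' with h | h
      · exact abs_le_max_abs_abs h.1 h.2
      · rw [max_comm]; exact abs_le_max_abs_abs h.1 h.2
    exact mul_le_mul h1 (abs_besselTerm_le ν m h2) (norm_nonneg _) ((norm_nonneg _).trans h1)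
  · exact Eventually.of_forall fun t _ => (summable_besselTerm_bound ν _).mul_left _
  · exact intervalIntegrable_const
  · exact Eventually.of_forall fun t _ => (hasSum_besselTerm ν t).mul_left _

/-- The integrated form of (t J₁)' = t J₀, term by term. -/
theorem integral_id_mul_besselJ_zero (s : ℝ) :
    ∫ t in (0 : ℝ)..s, t * besselJ 0 t = s * besselJ 1 s := by
  refine (hasSum_integral_mul_besselTerm 0 continuous_id 0 s).unique ?_
  convert! (hasSum_besselTerm 1 s).mul_left s using 1
  ext m
  have h1 : ∀ t : ℝ, id t * besselTerm 0 m t =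
      ((-1) ^ m / ((m.factorial : ℝ) * (m.factorial : ℝ)) / 2 ^ (2 * m)) * t ^ (2 * m + 1) := by
    intro t
    simp only [besselTerm, id, add_zero, div_pow]
    ring
  simp_rw [h1]
  rw [intervalIntegral.integral_const_mul, integral_pow, besselTerm, Nat.factorial_succ]
  have hf0 : (m.factorial : ℝ) ≠ 0 := by exact_mod_cast Nat.factorial_ne_zero _
  have : (m : ℝ) + 1 ≠ 0 := by positivity
  push_cast
  rw [zero_pow (by omega), div_pow]
  have h3 : (2 * (m : ℝ) + 1 + 1) = 2 * (m + 1) := by ring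
  rw [h3]
  field_simp
  ring

theorem besselJ_zero_zero : besselJ 0 0 = 1 := by
  refine (hasSum_besselTerm 0 0).unique ?_
  convert! hasSum_ite_eq (0 : ℕ) (1 : ℝ) using 1
  ext m
  rcases m with _ | m <;> simp [besselTerm]

theorem integral_besselJ_one (s : ℝ) : ∫ t in (0 : ℝ)..s, besselJ 1 t = 1 - besselJ 0 s := by
  have h := hasSum_integral_mul_besselTerm 1 (continuous_const (y := (1 : ℝ))) 0 s
  simp only [one_mul] at h
  refine h.unique ?_
  -- In J₀' = -J₁ the m-th term of J₁ comes from term m + 1 of J₀, so the constant term is split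
  -- off.
  have h0 := (hasSum_nat_add_iff' 1).2 (hasSum_besselTerm 0 s)
  simp only [Finset.range_one, Finset.sum_singleton] at h0
  have h00 : besselTerm 0 0 s = 1 := by simp [besselTerm]
  rw [h00] at h0
  convert! h0.neg using 1
  · ext m
    have h1 : ∀ t : ℝ, besselTerm 1 m t =
        ((-1) ^ m / ((m.factorial : ℝ) * ((m + 1).factorial : ℝ)) / 2 ^ (2 * m + 1))
          * t ^ (2 * m + 1) := by
      intro t
      simp only [besselTerm, div_pow]
      ring
    simp_rw [h1]
    rw [intervalIntegral.integral_const_mul, integral_pow, besselTerm, Nat.factorial_succ]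
    have hf0 : (m.factorial : ℝ) ≠ 0 := by exact_mod_cast Nat.factorial_ne_zero _
    have : (m : ℝ) + 1 ≠ 0 := by positivity
    push_cast
    rw [zero_pow (by omega), div_pow, add_zero]
    have h3 : (2 * (m : ℝ) + 1 + 1) = 2 * (m + 1) := by ring
    rw [h3]
    field_simp
    ring
  · ring

/-- Expand the cosine and integrate termwise: the integrals of the even powers of sin are Wallis
products, which turn (2m)! into 4^m (m!)². -/
theorem besselJ_zero_eq_integral_sin (t : ℝ) :
    besselJ 0 t = Real.pi⁻¹ * ∫ φ in (0 : ℝ)..Real.pi, Real.cos (t * Real.sin φ) := by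
  have h : HasSum (fun m : ℕ => ∫ φ in (0 : ℝ)..Real.pi,
      (-1) ^ m * (t * Real.sin φ) ^ (2 * m) / ((2 * m).factorial : ℝ))
      (∫ φ in (0 : ℝ)..Real.pi, Real.cos (t * Real.sin φ)) := by
    refine intervalIntegral.hasSum_integral_of_dominated_convergence
      (fun m _ => |t| ^ (2 * m) / ((2 * m).factorial : ℝ)) ?_ ?_ ?_ ?_ ?_
    · intro m
      exact Continuous.aestronglyMeasurable (by fun_prop)
    · refine fun m => Eventually.of_forall fun φ _ => ?_
      rw [Real.norm_eq_abs, abs_div, abs_mul, abs_pow, abs_neg, abs_one, one_pow, one_mul, abs_pow,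
        abs_mul, Nat.abs_cast]
      gcongr
      exact mul_le_of_le_one_right (abs_nonneg _) (Real.abs_sin_le_one _)
    · refine Eventually.of_forall fun φ _ => ?_
      exact (Real.summable_pow_div_factorial |t|).comp_injective
        (mul_right_injective₀ (two_ne_zero))
    · exact intervalIntegrable_const
    · exact Eventually.of_forall fun φ _ => Real.hasSum_cos _
  refine (hasSum_besselTerm 0 t).unique ?_
  convert! h.mul_left Real.pi⁻¹ using 1
  ext m
  have h1 : ∀ φ : ℝ, (-1) ^ m * (t * Real.sin φ) ^ (2 * m) / ((2 * m).factorial : ℝ) =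
      ((-1) ^ m * t ^ (2 * m) / ((2 * m).factorial : ℝ)) * Real.sin φ ^ (2 * m) := by
    intro φ; rw [mul_pow]; ring
  simp_rw [h1]
  have h2 : ∏ i ∈ Finset.range m, ((2 * (i : ℝ) + 1) / (2 * i + 2)) =
      ((2 * m).factorial : ℝ) / (4 ^ m * (m.factorial : ℝ) ^ 2) := by
    induction m with
    | zero => simp
    | succ m ih =>
      rw [Finset.prod_range_succ, ih (fun φ => by rw [mul_pow]; ring),
        show 2 * (m + 1) = 2 * m + 1 + 1 by ring, Nat.factorial_succ,
        Nat.factorial_succ, Nat.factorial_succ]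
      have hf0 : (m.factorial : ℝ) ≠ 0 := by exact_mod_cast Nat.factorial_ne_zero _
      push_cast
      field_simp
      ring
  rw [intervalIntegral.integral_const_mul, integral_sin_pow_even, h2, besselTerm, div_pow, add_zero,
    add_zero, pow_mul 2]
  have hf0 : (m.factorial : ℝ) ≠ 0 := by exact_mod_cast Nat.factorial_ne_zero _
  have hf1 : ((2 * m).factorial : ℝ) ≠ 0 := by exact_mod_cast Nat.factorial_ne_zero _
  have := Real.pi_ne_zero
  norm_num
  field_simp

theorem abs_besselJ_zero_le_one (t : ℝ) : |besselJ 0 t| ≤ 1 := by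
  have h := intervalIntegral.norm_integral_le_of_norm_le_const (a := 0) (b := Real.pi)
    (f := fun φ => Real.cos (t * Real.sin φ)) (C := 1)
    (fun φ _ => by simpa using Real.abs_cos_le_one _)
  rw [besselJ_zero_eq_integral_sin, abs_mul, abs_of_pos (inv_pos.2 Real.pi_pos)]
  rw [Real.norm_eq_abs, sub_zero, abs_of_pos Real.pi_pos, one_mul] at h
  calc _ ≤ Real.pi⁻¹ * Real.pi := by gcongr
    _ = 1 := inv_mul_cancel₀ Real.pi_ne_zero

theorem besselJ_zero_neg (t : ℝ) : besselJ 0 (-t) = besselJ 0 t := by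
  simp only [besselJ_zero_eq_integral_sin, neg_mul, Real.cos_neg]

theorem besselJ_zero_abs (t : ℝ) : besselJ 0 |t| = besselJ 0 t := by
  rcases abs_cases t with ⟨h, _⟩ | ⟨h, _⟩ <;> simp [h, besselJ_zero_neg]

theorem besselJ_one_neg (t : ℝ) : besselJ 1 (-t) = -besselJ 1 t := by
  refine (hasSum_besselTerm 1 (-t)).unique ?_
  convert! (hasSum_besselTerm 1 t).neg using 1
  ext m
  have : (-t / 2) ^ (2 * m + 1) = - (t / 2) ^ (2 * m + 1) := by
    rw [neg_div, Odd.neg_pow ⟨m, rfl⟩]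
  rw [besselTerm, besselTerm, this]
  ring

theorem jOne_neg (t : ℝ) : jOne (-t) = jOne t := by
  simp [jOne, besselJ_one_neg]

/-- `J_0` as a mean value over the circle, with an arbitrary phase. -/
theorem integral_cos_mul_cos_sub (t φ₀ : ℝ) :
    ∫ φ in (-Real.pi)..Real.pi, Real.cos (t * Real.cos (φ - φ₀)) =
      2 * Real.pi * besselJ 0 t := by
  -- The period is π, not 2π, since the cosine is even. Thus the phase drops out and the integral is
  -- twice the one over [0, π].
  have hper : Function.Periodic (fun φ => Real.cos (t * Real.sin φ)) Real.pi := by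
    intro φ
    simp [Real.sin_add_pi]
  have hint : ∀ a b, IntervalIntegrable (fun φ => Real.cos (t * Real.sin φ)) volume a b :=
    fun a b => Continuous.intervalIntegrable (by fun_prop) _ _
  have h1 : ∀ φ : ℝ, Real.cos (t * Real.cos (φ - φ₀)) =
      Real.cos (t * Real.sin (φ + (Real.pi / 2 - φ₀))) := by
    intro φ
    rw [← Real.cos_sub_pi_div_two]
    congr 3; ring
  simp_rw [h1]
  rw [intervalIntegral.integral_comp_add_right (fun φ => Real.cos (t * Real.sin φ)),
    besselJ_zero_eq_integral_sin]
  set c := Real.pi / 2 - φ₀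
  rw [← intervalIntegral.integral_add_adjacent_intervals (hint (-Real.pi + c) c) (hint _ _)]
  have e1 := hper.intervalIntegral_add_eq (-Real.pi + c) 0
  have e2 := hper.intervalIntegral_add_eq c 0
  rw [zero_add] at e1 e2
  rw [show -Real.pi + c + Real.pi = c by ring] at e1
  rw [e1, add_comm Real.pi c, e2]
  have := Real.pi_ne_zero
  field_simp
  ring

end Bessel

/-! ### Decay of J₀ at infinity. -/

section Decay

/-- The substitution v = sin φ exhibits π J₀(2πw) as the real part of the Fourier integral of 1/√(1
- v²) over (-1, 1); the Riemann–Lebesgue lemma applies. -/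
theorem tendsto_besselJ_zero_atTop : Tendsto (besselJ 0) atTop (𝓝 0) := by
  set s := Set.Ioo (-(Real.pi / 2)) (Real.pi / 2) with hs
  have hinj : Set.InjOn Real.sin s := Real.injOn_sin.mono Set.Ioo_subset_Icc_self
  let f : ℝ → ℂ := (Real.sin '' s).indicator fun v => ((Real.sqrt (1 - v ^ 2))⁻¹ : ℝ)
  have hmeas : MeasurableSet (Real.sin '' s) :=
    measurableSet_Ioo.image_of_continuousOn_injOn Real.continuous_sin.continuousOn hinj
  have key : ∀ w : ℝ, (∫ v : ℝ, Real.fourierChar (-(v * w)) • f v).re =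
      Real.pi * besselJ 0 (2 * Real.pi * w) := by
    intro w
    have h1 : ∀ v : ℝ, Real.fourierChar (-(v * w)) • f v = (Real.sin '' s).indicator
        (fun v => Complex.exp (((2 * Real.pi * -(v * w) : ℝ) : ℂ) * Complex.I) *
          ((Real.sqrt (1 - v ^ 2))⁻¹ : ℝ)) v := by
      intro v
      by_cases hv : v ∈ Real.sin '' s
      · simp only [f, Set.indicator_of_mem hv, Circle.smul_def, Real.fourierChar_apply, smul_eq_mul]
      · simp only [f, Set.indicator_of_notMem hv, smul_zero]
    simp_rw [h1]
    rw [integral_indicator hmeas, integral_image_eq_integral_abs_deriv_smul measurableSet_Ioo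
      (fun x _ => (Real.hasDerivAt_sin x).hasDerivWithinAt) hinj]
    have h2 : ∀ φ ∈ s, |Real.cos φ| •
        (Complex.exp (((2 * Real.pi * -(Real.sin φ * w) : ℝ) : ℂ) * Complex.I) *
          ((Real.sqrt (1 - Real.sin φ ^ 2))⁻¹ : ℝ)) =
        Complex.exp (((2 * Real.pi * -(Real.sin φ * w) : ℝ) : ℂ) * Complex.I) := by
      intro φ hφ
      have hc : 0 < Real.cos φ := Real.cos_pos_of_mem_Ioo hφ
      rw [← Real.abs_cos_eq_sqrt_one_sub_sin_sq, abs_of_pos hc, Complex.real_smul, mul_left_comm,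
        ← Complex.ofReal_mul, mul_inv_cancel₀ hc.ne', Complex.ofReal_one, mul_one]
    rw [setIntegral_congr_fun measurableSet_Ioo h2]
    have hint : Integrable (fun φ : ℝ =>
        Complex.exp (((2 * Real.pi * -(Real.sin φ * w) : ℝ) : ℂ) * Complex.I))
        (volume.restrict s) := by
      have : Continuous fun φ : ℝ =>
        Complex.exp (((2 * Real.pi * -(Real.sin φ * w) : ℝ) : ℂ) * Complex.I) := by fun_prop
      exact (this.continuousOn.integrableOn_Icc).mono_set Set.Ioo_subset_Icc_self
    have h3 := integral_re hint
    simp only [RCLike.re_to_complex] at h3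
    rw [← h3]
    simp_rw [Complex.exp_ofReal_mul_I_re]
    have h4 : ∀ φ : ℝ, Real.cos (2 * Real.pi * -(Real.sin φ * w)) =
        Real.cos ((2 * Real.pi * w) * Real.sin φ) := by
      intro φ
      rw [← Real.cos_neg]; congr 1; ring
    simp_rw [h4]
    have hper : Function.Periodic (fun φ => Real.cos ((2 * Real.pi * w) * Real.sin φ)) Real.pi := by
      intro φ
      simp [Real.sin_add_pi]
    have e1 := hper.intervalIntegral_add_eq (-(Real.pi / 2)) 0
    rw [zero_add, show -(Real.pi / 2) + Real.pi = Real.pi / 2 by ring] at e1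
    rw [hs, ← integral_Ioc_eq_integral_Ioo,
      ← intervalIntegral.integral_of_le (by linarith [Real.pi_pos]), e1,
      besselJ_zero_eq_integral_sin, ← mul_assoc, mul_inv_cancel₀ Real.pi_ne_zero, one_mul]
  -- Integrability of `f` need not be checked: a nonintegrable function has integral 0, so the lemma
  -- holds for every function.
  have h := (Real.tendsto_integral_exp_smul_cocompact f).mono_left atTop_le_cocompact
  have h' := (Complex.continuous_re.tendsto _).comp h
  simp only [Function.comp_def, key, Complex.zero_re] at h'
  have h2 : Tendsto (fun t : ℝ => t / (2 * Real.pi)) atTop atTop :=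
    tendsto_id.atTop_div_const (by positivity)
  have h3 := (h'.comp h2).const_mul Real.pi⁻¹
  refine (h3.congr fun t => ?_).trans (by simp)
  have := Real.pi_ne_zero
  simp only [Function.comp_def]
  rw [← mul_assoc, inv_mul_cancel₀ this, one_mul]
  congr 1
  field_simp

end Decay

/-! ### Polar coordinates. -/

section Polar

/-- Polar coordinates for the integral of a continuous function over a bounded set. -/
theorem setIntegral_eq_polar {S : Set ℂ} (hS : MeasurableSet S) {G : ℂ → ℝ} (hG : Continuous G)
    {M : ℝ} (hM : S ⊆ Metric.closedBall 0 M) :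
    ∫ z in S, G z = ∫ φ in (-Real.pi)..Real.pi, ∫ r in Set.Ioc 0 M,
      {r : ℝ | (r * Complex.exp (φ * Complex.I) : ℂ) ∈ S}.indicator
        (fun r => r * G (r * Complex.exp (φ * Complex.I))) r := by
  have hsymm : ∀ p : ℝ × ℝ, Complex.polarCoord.symm p = p.1 * Complex.exp (p.2 * Complex.I) := by
    intro p
    rw [Complex.polarCoord_symm_apply, Complex.exp_mul_I]
    simp
  let T : Set (ℝ × ℝ) := {p | (p.1 * Complex.exp (p.2 * Complex.I) : ℂ) ∈ S}
  have hcont : Continuous fun p : ℝ × ℝ => (p.1 * Complex.exp (p.2 * Complex.I) : ℂ) := by fun_prop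
  have hT : MeasurableSet T := hcont.measurable hS
  let F : ℝ × ℝ → ℝ := T.indicator fun p => p.1 * G (p.1 * Complex.exp (p.2 * Complex.I))
  have hFc : Continuous fun p : ℝ × ℝ => p.1 * G (p.1 * Complex.exp (p.2 * Complex.I)) := by
    fun_prop
  have hsub : Set.Ioc 0 M ×ˢ Set.Ioo (-Real.pi) Real.pi ⊆ polarCoord.target := by
    rintro ⟨r, φ⟩ ⟨h1, h2⟩
    exact ⟨h1.1, h2⟩
  rw [← integral_indicator hS, ← Complex.integral_comp_polarCoord_symm]
  have h1 : ∀ p : ℝ × ℝ, p.1 • S.indicator G (Complex.polarCoord.symm p) = F p := by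
    intro p
    rw [hsymm]
    by_cases hp : p ∈ T
    · have hp' : (p.1 * Complex.exp (p.2 * Complex.I) : ℂ) ∈ S := hp
      simp only [F, Set.indicator_of_mem hp, Set.indicator_of_mem hp', smul_eq_mul]
    · have hp' : (p.1 * Complex.exp (p.2 * Complex.I) : ℂ) ∉ S := hp
      simp only [F, Set.indicator_of_notMem hp, Set.indicator_of_notMem hp', smul_zero]
  simp_rw [h1]
  -- The integrand vanishes for radii beyond `M`; cutting there leaves a bounded rectangle, on which
  -- Fubini applies.
  rw [setIntegral_eq_of_subset_of_forall_sdiff_eq_zero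
    (polarCoord.open_target.measurableSet) hsub]
  · have hint : IntegrableOn F (Set.Ioc 0 M ×ˢ Set.Ioo (-Real.pi) Real.pi) := by
      refine IntegrableOn.mono_set (t := Set.Icc 0 M ×ˢ Set.Icc (-Real.pi) Real.pi) ?_
        (Set.prod_mono Set.Ioc_subset_Icc_self Set.Ioo_subset_Icc_self)
      refine IntegrableOn.indicator ?_ hT
      exact hFc.continuousOn.integrableOn_compact (isCompact_Icc.prod isCompact_Icc)
    rw [intervalIntegral.integral_of_le (by linarith [Real.pi_pos]), integral_Ioc_eq_integral_Ioo]
    rw [Measure.volume_eq_prod, ← setIntegral_prod_swap, setIntegral_prod]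
    · rfl
    · have := hint.swap
      exact this
  · rintro ⟨r, φ⟩ ⟨hp, hp'⟩
    refine Set.indicator_of_notMem (fun hT' => hp' ⟨⟨hp.1, ?_⟩, hp.2⟩) _
    have := hM hT'
    rw [mem_closedBall_zero_iff, norm_mul, Complex.norm_exp_ofReal_mul_I, mul_one,
      Complex.norm_real, Real.norm_eq_abs, abs_of_pos hp.1] at this
    exact this

end Polar

/-! ### The characteristic function of the disc of area 1. -/

section Disc

theorem discRadius_pos : 0 < discRadius := by
  unfold discRadius
  have := Real.pi_pos
  positivity

theorem pi_mul_discRadius_sq : Real.pi * discRadius ^ 2 = 1 := by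
  unfold discRadius
  rw [div_pow, Real.sq_sqrt Real.pi_pos.le, one_pow, mul_one_div_cancel Real.pi_ne_zero]

theorem inner_polar (w : ℂ) (r φ : ℝ) :
    inner ℝ w (r * Complex.exp (φ * Complex.I)) = r * (‖w‖ * Real.cos (φ - w.arg)) := by
  rw [Complex.inner]
  conv_lhs => rw [← Complex.norm_mul_exp_arg_mul_I w]
  rw [map_mul, Complex.conj_ofReal, ← Complex.exp_conj, map_mul, Complex.conj_I,
    Complex.conj_ofReal]
  have : (r * Complex.exp (φ * Complex.I) * (‖w‖ * Complex.exp (w.arg * -Complex.I)) : ℂ) =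
      ((r * ‖w‖ : ℝ) : ℂ) * Complex.exp (((φ - w.arg : ℝ) : ℂ) * Complex.I) := by
    have : Complex.exp (((φ - w.arg : ℝ) : ℂ) * Complex.I) =
        Complex.exp (φ * Complex.I) * Complex.exp (w.arg * -Complex.I) := by
      rw [← Complex.exp_add]; congr 1; push_cast; ring
    rw [this]; push_cast; ring
  rw [this, Complex.re_ofReal_mul, Complex.exp_ofReal_mul_I_re]
  ring

theorem besselJ_one_eq_jOne (t : ℝ) : besselJ 1 t = t * jOne t / 2 := by
  unfold jOne
  split_ifs with h
  · subst h
    have h0 := integral_id_mul_besselJ_zero 0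
    refine (hasSum_besselTerm 1 0).unique ?_
    convert! hasSum_zero using 1
    · ext m; simp [besselTerm]
    · simp
  · field_simp

/-- In polar coordinates the angular integral gives 2π J₀(r‖w‖), and the radial integral of r J₀
gives J₁. The constant is 1 because π α² = 1. -/
theorem integral_closedBall_cos_inner (w : ℂ) :
    ∫ z in Metric.closedBall (0 : ℂ) discRadius, Real.cos (inner ℝ w z) =
      jOne (discRadius * ‖w‖) := by
  have hα := discRadius_pos
  rw [setIntegral_eq_polar measurableSet_closedBall (by fun_prop) subset_rfl]
  have h1 : ∀ φ : ℝ, ∫ r in Set.Ioc 0 discRadius,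
      {r : ℝ | (r * Complex.exp (φ * Complex.I) : ℂ) ∈ Metric.closedBall 0 discRadius}.indicator
        (fun r => r * Real.cos (inner ℝ w (r * Complex.exp (φ * Complex.I)))) r =
      ∫ r in (0 : ℝ)..discRadius, r * Real.cos (r * ‖w‖ * Real.cos (φ - w.arg)) := by
    intro φ
    rw [intervalIntegral.integral_of_le hα.le]
    refine setIntegral_congr_fun measurableSet_Ioc fun r hr => ?_
    rw [Set.indicator_of_mem, inner_polar, mul_assoc]
    simp only [Set.mem_ofPred_eq, mem_closedBall_zero_iff, norm_mul,
      Complex.norm_exp_ofReal_mul_I, mul_one, Complex.norm_real, Real.norm_eq_abs, abs_of_pos hr.1]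
    exact hr.2
  simp_rw [h1]
  rw [intervalIntegral_intervalIntegral_swap]
  · simp_rw [intervalIntegral.integral_const_mul, integral_cos_mul_cos_sub]
    by_cases hw : ‖w‖ = 0
    · have h2 : ∀ r : ℝ, r * (2 * Real.pi * besselJ 0 (r * ‖w‖)) = (2 * Real.pi) * r := by
        intro r; rw [hw, mul_zero, besselJ_zero_zero]; ring
      simp_rw [h2]
      rw [intervalIntegral.integral_const_mul, integral_id, hw, mul_zero, jOne, if_pos rfl]
      linarith [pi_mul_discRadius_sq]
    · have h2 : ∀ r : ℝ, r * (2 * Real.pi * besselJ 0 (r * ‖w‖)) =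
          (2 * Real.pi * ‖w‖⁻¹) * ((fun t => t * besselJ 0 t) (r * ‖w‖)) := by
        intro r; field_simp
      simp_rw [h2]
      rw [intervalIntegral.integral_const_mul,
        intervalIntegral.integral_comp_mul_right (fun t => t * besselJ 0 t) hw, zero_mul,
        integral_id_mul_besselJ_zero, besselJ_one_eq_jOne, smul_eq_mul]
      have := pi_mul_discRadius_sq
      field_simp
      rw [mul_comm ‖w‖ discRadius]
      linear_combination (jOne (discRadius * ‖w‖)) * this
  · have hc : Continuous (Function.uncurry fun φ r : ℝ =>
        r * Real.cos (r * ‖w‖ * Real.cos (φ - w.arg))) := by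
      simp only [Function.uncurry_def]; fun_prop
    exact (hc.continuousOn.integrableOn_compact (isCompact_uIcc.prod isCompact_uIcc)).mono_set
      (Set.prod_mono Set.uIoc_subset_uIcc Set.uIoc_subset_uIcc)

/-- As an integral of cosines over a set of finite measure, the function is continuous by dominated
convergence, also at the removable singularity 0. -/
theorem continuous_jOne : Continuous jOne := by
  have h : jOne = fun t : ℝ => ∫ z in Metric.closedBall (0 : ℂ) discRadius,
      Real.cos (inner ℝ ((t / discRadius : ℝ) : ℂ) z) := by
    ext t
    rw [integral_closedBall_cos_inner, Complex.norm_real, Real.norm_eq_abs, abs_div,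
      abs_of_pos discRadius_pos, mul_div_cancel₀ _ discRadius_pos.ne']
    rcases abs_cases t with ⟨h, _⟩ | ⟨h, _⟩ <;> simp [h, jOne_neg]
  rw [h]
  refine continuous_of_dominated (bound := fun _ => 1) ?_ ?_ ?_ ?_
  · intro t; exact Continuous.aestronglyMeasurable (by fun_prop)
  · exact fun t => Eventually.of_forall fun z => by simpa using Real.abs_cos_le_one _
  · exact integrableOn_const (by simp [Complex.volume_closedBall]; finiteness)
  · exact Eventually.of_forall fun z => by fun_prop

end Disc

/-! ### The sine integral and Dirichlet's discontinuous factor. -/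

section SineIntegral

/-- The sine integral `∫₀ᵗ sin x / x dx`. -/
noncomputable def sineIntegral (t : ℝ) : ℝ := ∫ x in (0 : ℝ)..t, Real.sinc x

theorem mul_sinc (x : ℝ) : x * Real.sinc x = Real.sin x := by
  by_cases h : x = 0
  · simp [h]
  · rw [Real.sinc_of_ne_zero h]; field_simp

theorem sineIntegral_neg (t : ℝ) : sineIntegral (-t) = -sineIntegral t := by
  have h := intervalIntegral.integral_comp_neg (a := 0) (b := t) (fun x => Real.sinc x)
  simp only [Real.sinc_neg, neg_zero] at h
  rw [sineIntegral, sineIntegral, intervalIntegral.integral_symm, ← h]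

theorem abs_sineIntegral_le (t : ℝ) : |sineIntegral t| ≤ |t| := by
  have h := intervalIntegral.norm_integral_le_of_norm_le_const (a := 0) (b := t)
    (f := Real.sinc) (C := 1) (fun x _ => Real.abs_sinc_le_one x)
  simpa [sineIntegral] using h

theorem integral_exp_neg_mul_mul_sin (u R : ℝ) :
    ∫ x in (0 : ℝ)..R, Real.exp (-(x * u)) * Real.sin x =
      (1 + u ^ 2)⁻¹ - Real.exp (-(R * u)) * (Real.cos R + u * Real.sin R) * (1 + u ^ 2)⁻¹ := by
  have hu : 1 + u ^ 2 ≠ 0 := by positivity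
  have h : ∀ x ∈ Set.uIcc 0 R, HasDerivAt
      (fun x => -(Real.exp (-(x * u)) * (Real.cos x + u * Real.sin x) * (1 + u ^ 2)⁻¹))
      (Real.exp (-(x * u)) * Real.sin x) x := by
    intro x _
    have h1 : HasDerivAt (fun x => Real.exp (-(x * u))) (Real.exp (-(x * u)) * (-(1 * u))) x :=
      (((hasDerivAt_id x).mul_const u).neg).exp
    have h2 : HasDerivAt (fun x => Real.cos x + u * Real.sin x)
        (-Real.sin x + u * Real.cos x) x :=
      (Real.hasDerivAt_cos x).add ((Real.hasDerivAt_sin x).const_mul u)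
    convert! ((h1.mul h2).mul_const (1 + u ^ 2)⁻¹).neg using 1
    field_simp
    ring
  rw [intervalIntegral.integral_eq_sub_of_hasDerivAt h
    (Continuous.intervalIntegrable (by fun_prop) _ _)]
  simp
  ring

theorem integral_Ioi_exp_neg_mul {x : ℝ} (hx : 0 < x) :
    ∫ u in Set.Ioi (0 : ℝ), Real.exp (-(x * u)) = x⁻¹ := by
  have := integral_exp_mul_Ioi (a := -x) (by linarith) 0
  simp only [neg_mul, mul_zero, Real.exp_zero] at this
  rw [this]
  field_simp

theorem integrableOn_Ioi_exp_neg_mul {x : ℝ} (hx : 0 < x) :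
    IntegrableOn (fun u => Real.exp (-(x * u))) (Set.Ioi (0 : ℝ)) := by
  have := integrableOn_exp_mul_Ioi (a := -x) (by linarith) 0
  simpa only [neg_mul] using this

/-- Write 1/x as ∫ exp(-xu) du and exchange the integrals. The main part is the integral of 1/(1 +
u²); the remainder is at most 2 ∫ exp(-Ru) du, since 1 + u ≤ 2 (1 + u²). -/
theorem sineIntegral_eq {R : ℝ} (hR : 0 < R) :
    sineIntegral R = Real.pi / 2 - ∫ u in Set.Ioi (0 : ℝ),
      Real.exp (-(R * u)) * (Real.cos R + u * Real.sin R) * (1 + u ^ 2)⁻¹ ∧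
    |sineIntegral R - Real.pi / 2| ≤ 2 / R := by
  have hb : ∀ u ∈ Set.Ioi (0 : ℝ),
      ‖Real.exp (-(R * u)) * (Real.cos R + u * Real.sin R) * (1 + u ^ 2)⁻¹‖ ≤
        2 * Real.exp (-(R * u)) := by
    intro u hu
    have hu : 0 < u := hu
    have h1 : |Real.cos R + u * Real.sin R| ≤ 1 + u := by
      refine (abs_add_le _ _).trans (add_le_add (Real.abs_cos_le_one _) ?_)
      rw [abs_mul, abs_of_pos hu]
      exact mul_le_of_le_one_right hu.le (Real.abs_sin_le_one _)
    rw [norm_mul, norm_mul, Real.norm_eq_abs, Real.norm_eq_abs, Real.norm_eq_abs, Real.abs_exp,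
      abs_of_pos (by positivity : 0 < (1 + u ^ 2)⁻¹), mul_assoc, mul_comm (2 : ℝ)]
    gcongr
    rw [← div_eq_mul_inv, div_le_iff₀ (by positivity)]
    nlinarith [sq_nonneg (u - 1)]
  have hi2 : IntegrableOn (fun u => 2 * Real.exp (-(R * u))) (Set.Ioi (0 : ℝ)) :=
    (integrableOn_Ioi_exp_neg_mul hR).const_mul 2
  have hi : IntegrableOn (fun u =>
      Real.exp (-(R * u)) * (Real.cos R + u * Real.sin R) * (1 + u ^ 2)⁻¹) (Set.Ioi (0 : ℝ)) := by
    refine Integrable.mono' hi2 (Measurable.aestronglyMeasurable (by fun_prop)) ?_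
    exact (ae_restrict_iff' measurableSet_Ioi).2 (Eventually.of_forall hb)
  have hfub : Integrable (Function.uncurry fun x u : ℝ => Real.exp (-(x * u)) * Real.sin x)
      ((volume.restrict (Set.uIoc 0 R)).prod (volume.restrict (Set.Ioi 0))) := by
    have hm : AEStronglyMeasurable
        (Function.uncurry fun x u : ℝ => Real.exp (-(x * u)) * Real.sin x)
        ((volume.restrict (Set.uIoc 0 R)).prod (volume.restrict (Set.Ioi 0))) := by
      refine Continuous.aestronglyMeasurable ?_
      simp only [Function.uncurry_def]; fun_prop
    rw [integrable_prod_iff hm, Set.uIoc_of_le hR.le]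
    constructor
    · refine (ae_restrict_iff' measurableSet_Ioc).2 (Eventually.of_forall fun x hx => ?_)
      exact (integrableOn_Ioi_exp_neg_mul hx.1).mul_const (Real.sin x)
    · have : IntegrableOn (fun x => |Real.sinc x|) (Set.Ioc 0 R) :=
        (Real.continuous_sinc.abs.continuousOn.integrableOn_Icc).mono_set Set.Ioc_subset_Icc_self
      refine this.congr_fun (fun x hx => ?_) measurableSet_Ioc
      simp only [Function.uncurry_apply_pair, norm_mul, Real.norm_eq_abs, Real.abs_exp]
      rw [integral_mul_const, integral_Ioi_exp_neg_mul hx.1, Real.sinc_of_ne_zero hx.1.ne',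
        abs_div, abs_of_pos hx.1]
      ring
  have heq : sineIntegral R = Real.pi / 2 - ∫ u in Set.Ioi (0 : ℝ),
      Real.exp (-(R * u)) * (Real.cos R + u * Real.sin R) * (1 + u ^ 2)⁻¹ := by
    have h1 : sineIntegral R =
        ∫ x in (0 : ℝ)..R, ∫ u in Set.Ioi (0 : ℝ), Real.exp (-(x * u)) * Real.sin x := by
      rw [sineIntegral, intervalIntegral.integral_of_le hR.le, intervalIntegral.integral_of_le hR.le]
      refine setIntegral_congr_fun measurableSet_Ioc fun x hx => ?_
      rw [integral_mul_const, integral_Ioi_exp_neg_mul hx.1, Real.sinc_of_ne_zero hx.1.ne']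
      ring
    rw [h1, intervalIntegral_integral_swap hfub]
    simp_rw [integral_exp_neg_mul_mul_sin]
    rw [integral_sub integrable_inv_one_add_sq.integrableOn hi, integral_Ioi_inv_one_add_sq]
    simp
  refine ⟨heq, ?_⟩
  rw [heq, sub_sub_cancel_left, abs_neg]
  refine (norm_integral_le_of_norm_le hi2
    ((ae_restrict_iff' measurableSet_Ioi).2 (Eventually.of_forall hb))).trans_eq ?_
  rw [integral_const_mul, integral_Ioi_exp_neg_mul hR]
  ring

theorem tendsto_sineIntegral_atTop : Tendsto sineIntegral atTop (𝓝 (Real.pi / 2)) := by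
  rw [tendsto_iff_norm_sub_tendsto_zero]
  refine squeeze_zero' (Eventually.of_forall fun _ => norm_nonneg _)
    ((eventually_gt_atTop 0).mono fun R hR => (sineIntegral_eq hR).2) ?_
  exact tendsto_const_nhds.div_atTop tendsto_id

/-- Up to 1 the bound |t| suffices; beyond, the error estimate gives π/2 + 2. Uniformity in `t` is
what dominated convergence needs later. -/
theorem abs_sineIntegral_le_four (t : ℝ) : |sineIntegral t| ≤ 4 := by
  have key : ∀ t : ℝ, 0 ≤ t → |sineIntegral t| ≤ 4 := by
    intro t ht
    rcases le_total t 1 with h | h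
    · have := abs_sineIntegral_le t
      rw [abs_of_nonneg ht] at this
      linarith
    · have h1 := (sineIntegral_eq (by linarith : 0 < t)).2
      have h2 : 2 / t ≤ 2 := by rw [div_le_iff₀ (by linarith)]; linarith
      have h3 := abs_sub_abs_le_abs_sub (sineIntegral t) (Real.pi / 2)
      rw [abs_of_pos (by positivity : 0 < Real.pi / 2)] at h3
      linarith [Real.pi_le_four]
  rcases le_total 0 t with h | h
  · exact key t h
  · have := key (-t) (by linarith)
    rwa [sineIntegral_neg, abs_neg] at this

theorem tendsto_sineIntegral_mul (c : ℝ) :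
    Tendsto (fun R => sineIntegral (c * R)) atTop (𝓝 (SignType.sign c * (Real.pi / 2))) := by
  rcases lt_trichotomy c 0 with h | h | h
  · have h1 : Tendsto (fun R => -c * R) atTop atTop := tendsto_id.const_mul_atTop (by linarith)
    have h2 := (tendsto_sineIntegral_atTop.comp h1).neg
    simp only [Function.comp_def, neg_mul, sineIntegral_neg, neg_neg] at h2
    simpa [sign_neg h] using h2
  · subst h
    simp [sineIntegral]
  · have h1 : Tendsto (fun R => c * R) atTop atTop := tendsto_id.const_mul_atTop h
    simpa [sign_pos h, Function.comp_def] using tendsto_sineIntegral_atTop.comp h1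

/-- The average of the two one-sided values of the indicator function of `[-ρ, ρ]`. -/
noncomputable def halfIndicator (ρ t : ℝ) : ℝ := if t < ρ then 1 else if t = ρ then 1 / 2 else 0

/-- The identity 2 sin A cos B = sin(A + B) + sin(A - B), divided by s. -/
theorem integral_sinc_mul_cos {b : ℝ} (hb : b ≠ 0) (y R : ℝ) :
    ∫ s in (0 : ℝ)..R, Real.sinc (b * s) * Real.cos (2 * s * y) =
      (2 * b)⁻¹ * (sineIntegral ((b + 2 * y) * R) + sineIntegral ((b - 2 * y) * R)) := by
  have hS : ∀ c : ℝ, ∫ s in (0 : ℝ)..R, c * Real.sinc (c * s) = sineIntegral (c * R) := by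
    intro c
    rw [intervalIntegral.integral_const_mul, intervalIntegral.mul_integral_comp_mul_left]
    simp [sineIntegral]
  rw [← hS, ← hS, ← intervalIntegral.integral_add, ← intervalIntegral.integral_const_mul]
  · refine intervalIntegral.integral_congr fun s _ => ?_
    by_cases hs : s = 0
    · subst hs; simp; field_simp; ring
    · have e1 := mul_sinc ((b + 2 * y) * s)
      have e2 := mul_sinc ((b - 2 * y) * s)
      have e3 := mul_sinc (b * s)
      have e4 : Real.sin ((b + 2 * y) * s) + Real.sin ((b - 2 * y) * s) =
          2 * (Real.sin (b * s) * Real.cos (2 * s * y)) := by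
        rw [show (b + 2 * y) * s = b * s + 2 * s * y by ring,
          show (b - 2 * y) * s = b * s - 2 * s * y by ring, Real.sin_add, Real.sin_sub]
        ring
      rw [← e1, ← e2, ← e3] at e4
      have : s * ((b + 2 * y) * Real.sinc ((b + 2 * y) * s) +
          (b - 2 * y) * Real.sinc ((b - 2 * y) * s)) =
          s * (2 * b * (Real.sinc (b * s) * Real.cos (2 * s * y))) := by linear_combination e4
      rw [mul_left_cancel₀ hs this]
      field_simp
  · exact ((Real.continuous_sinc.comp (by fun_prop)).const_mul _).intervalIntegrable _ _
  · exact ((Real.continuous_sinc.comp (by fun_prop)).const_mul _).intervalIntegrable _ _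

theorem abs_integral_sinc_mul_cos_le {b : ℝ} (hb : b ≠ 0) (y R : ℝ) :
    |∫ s in (0 : ℝ)..R, Real.sinc (b * s) * Real.cos (2 * s * y)| ≤ 4 / |b| := by
  rw [integral_sinc_mul_cos hb, abs_mul, abs_inv, abs_mul, abs_two]
  have h := (abs_add_le (sineIntegral ((b + 2 * y) * R)) (sineIntegral ((b - 2 * y) * R))).trans
    (add_le_add (abs_sineIntegral_le_four _) (abs_sineIntegral_le_four _))
  have hb' := abs_pos.2 hb
  calc _ ≤ (2 * |b|)⁻¹ * (4 + 4) := by gcongr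
    _ = _ := by field_simp; norm_num

/-- The limit is governed by sign(b + 2y) + sign(b - 2y): the signs agree for 2|y| < |b| and cancel
for 2|y| > |b|, and one of them is 0 at equality, which produces the value 1/2. -/
theorem tendsto_integral_sinc_mul_cos {b : ℝ} (hb : b ≠ 0) (y : ℝ) :
    Tendsto (fun R => ∫ s in (0 : ℝ)..R, Real.sinc (b * s) * Real.cos (2 * s * y)) atTop
      (𝓝 (Real.pi / (2 * |b|) * halfIndicator (|b| * (1 / 2)) |y|)) := by
  simp_rw [integral_sinc_mul_cos hb]
  refine (((tendsto_sineIntegral_mul (b + 2 * y)).add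
    (tendsto_sineIntegral_mul (b - 2 * y))).const_mul (2 * b)⁻¹).trans_eq ?_
  congr 1
  unfold halfIndicator
  rcases abs_cases b with ⟨e1, h1⟩ | ⟨e1, h1⟩ <;> rcases abs_cases y with ⟨e2, h2⟩ | ⟨e2, h2⟩ <;>
    rw [e1, e2] <;> rcases lt_trichotomy (b + 2 * y) 0 with h3 | h3 | h3 <;>
    rcases lt_trichotomy (b - 2 * y) 0 with h4 | h4 | h4 <;>
    first
    | (exfalso; first | linarith | exact hb (by linarith))
    | (simp only [h3, h4, sign_neg, sign_pos, sign_zero, SignType.coe_one, SignType.coe_neg_one,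
        SignType.coe_zero]
       first
       | (rw [if_pos (by linarith)]; field_simp; norm_num)
       | (rw [if_neg (by linarith), if_pos (by linarith)]; field_simp; norm_num)
       | (rw [if_neg (by linarith), if_neg (fun h => by linarith)]; ring))

end SineIntegral

/-! ### Characteristic functions and means of Bessel functions. -/

section CharFun

/-- The characteristic function of a linear combination of independent variables. -/
theorem integral_pi_exp_inner_sum {κ E : Type*} [Fintype κ] [NormedAddCommGroup E]
    [InnerProductSpace ℝ E] [MeasurableSpace E] (ν : Measure E) [IsFiniteMeasure ν]
    {g : ℝ → ℝ}
    (hg : ∀ w : E, ∫ z, Complex.exp ((inner ℝ w z : ℝ) * Complex.I) ∂ν = (g ‖w‖ : ℂ))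
    (a : κ → ℝ) (w : E) :
    ∫ z, Complex.exp ((inner ℝ w (∑ j, a j • z j) : ℝ) * Complex.I) ∂(Measure.pi fun _ : κ => ν) =
      ((∏ j, g (|a j| * ‖w‖) : ℝ) : ℂ) := by
  have h : ∀ z : κ → E, Complex.exp ((inner ℝ w (∑ j, a j • z j) : ℝ) * Complex.I) =
      ∏ j, Complex.exp ((inner ℝ (a j • w) (z j) : ℝ) * Complex.I) := by
    intro z
    rw [← Complex.exp_sum, ← Finset.sum_mul, ← Complex.ofReal_sum, inner_sum]
    simp_rw [real_inner_smul_left, real_inner_smul_right]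
  simp_rw [h]
  rw [integral_fintype_prod_eq_prod
    (fun j (x : E) => Complex.exp ((inner ℝ (a j • w) x : ℝ) * Complex.I))]
  simp_rw [hg, norm_smul, Real.norm_eq_abs]
  push_cast
  rfl

variable {E : Type*} [NormedAddCommGroup E] [InnerProductSpace ℝ E]
  [MeasurableSpace E] [BorelSpace E] [SecondCountableTopology E]

/-- The ball is symmetric under z ↦ -z, so the odd sine part integrates to 0. -/
theorem integral_closedBall_exp_inner [FiniteDimensional ℝ E] (α : ℝ) (w : E) :
    ∫ z in Metric.closedBall (0 : E) α, Complex.exp ((inner ℝ w z : ℝ) * Complex.I) =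
      ((∫ z in Metric.closedBall (0 : E) α, Real.cos (inner ℝ w z) : ℝ) : ℂ) := by
  have hc : IntegrableOn (fun z => Real.cos (inner ℝ w z)) (Metric.closedBall (0 : E) α) :=
    ContinuousOn.integrableOn_compact (isCompact_closedBall _ _) (by fun_prop)
  have hs : IntegrableOn (fun z => Real.sin (inner ℝ w z)) (Metric.closedBall (0 : E) α) :=
    ContinuousOn.integrableOn_compact (isCompact_closedBall _ _) (by fun_prop)
  have hs0 : ∫ z in Metric.closedBall (0 : E) α, Real.sin (inner ℝ w z) = 0 := by
    rw [← integral_indicator measurableSet_closedBall]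
    set f := (Metric.closedBall (0 : E) α).indicator fun z => Real.sin (inner ℝ w z)
    have h1 : ∀ z, f (-z) = -f z := by
      intro z
      by_cases hz : z ∈ Metric.closedBall (0 : E) α
      · have hz' : -z ∈ Metric.closedBall (0 : E) α := by simpa using hz
        simp only [f, Set.indicator_of_mem hz, Set.indicator_of_mem hz', inner_neg_right,
          Real.sin_neg]
      · have hz' : -z ∉ Metric.closedBall (0 : E) α := by simpa using hz
        simp only [f, Set.indicator_of_notMem hz, Set.indicator_of_notMem hz', neg_zero]
    have h2 := integral_neg_eq_self f volume
    simp_rw [h1] at h2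
    rw [integral_neg] at h2
    linarith
  have h : ∀ z : E, Complex.exp ((inner ℝ w z : ℝ) * Complex.I) =
      ((Real.cos (inner ℝ w z) : ℝ) : ℂ) + ((Real.sin (inner ℝ w z) : ℝ) : ℂ) * Complex.I := by
    intro z
    rw [Complex.exp_mul_I, Complex.ofReal_cos, Complex.ofReal_sin]
  simp_rw [h]
  rw [integral_add hc.ofReal (hs.ofReal.mul_const _), integral_mul_const, integral_complex_ofReal,
    integral_complex_ofReal, hs0]
  simp

variable {Ω : Type*} [MeasurableSpace Ω] {μ : Measure Ω} [IsFiniteMeasure μ]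

/-- The exponential of the sum factors, and since `c` is real, taking real parts keeps only the
cosine of the constant shift. -/
theorem integral_cos_inner_add {X : Ω → E} (hX : Measurable X) {w : E} {c : ℝ}
    (h : ∫ ω, Complex.exp ((inner ℝ w (X ω) : ℝ) * Complex.I) ∂μ = c) (y : E) :
    ∫ ω, Real.cos (inner ℝ w (y + X ω)) ∂μ = Real.cos (inner ℝ w y) * c := by
  have h1 : ∀ ω, Real.cos (inner ℝ w (y + X ω)) = (Complex.exp ((inner ℝ w y : ℝ) * Complex.I) *
      Complex.exp ((inner ℝ w (X ω) : ℝ) * Complex.I)).re := by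
    intro ω
    rw [← Complex.exp_add, ← add_mul, ← Complex.ofReal_add, Complex.exp_ofReal_mul_I_re,
      inner_add_right]
  have hint : Integrable (fun ω => Complex.exp ((inner ℝ w y : ℝ) * Complex.I) *
      Complex.exp ((inner ℝ w (X ω) : ℝ) * Complex.I)) μ := by
    refine Integrable.const_mul (Integrable.of_bound (C := 1) ?_ ?_) _
    · exact Measurable.aestronglyMeasurable (by fun_prop)
    · exact Eventually.of_forall fun ω => by rw [Complex.norm_exp_ofReal_mul_I]
  have h2 := integral_re hint
  simp only [RCLike.re_to_complex] at h2
  simp_rw [h1]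
  rw [h2, integral_const_mul, h, Complex.re_mul_ofReal, Complex.exp_ofReal_mul_I_re]

/-- Averaging over the directions turns cosines into Bessel functions. -/
theorem integral_besselJ_zero_norm_add {X : Ω → ℂ} (hX : Measurable X) {t c : ℝ} (y : ℂ)
    (h : ∀ w : ℂ, ‖w‖ = |t| → ∫ ω, Real.cos (inner ℝ w (y + X ω)) ∂μ = Real.cos (inner ℝ w y) * c) :
    ∫ ω, besselJ 0 (t * ‖y + X ω‖) ∂μ = besselJ 0 (t * ‖y‖) * c := by
  -- J₀(t‖v‖) is the mean of cos⟨w, v⟩ over the circle ‖w‖ = |t|, and `h` applies at each w of this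
  -- circle.
  have key : ∀ v : ℂ, besselJ 0 (t * ‖v‖) = (2 * Real.pi)⁻¹ *
      ∫ φ in (-Real.pi)..Real.pi, Real.cos (inner ℝ (t * Complex.exp (φ * Complex.I)) v) := by
    intro v
    simp_rw [real_inner_comm, inner_polar, ← mul_assoc]
    rw [integral_cos_mul_cos_sub]
    have := Real.pi_ne_zero
    field_simp
  simp_rw [key]
  rw [integral_const_mul, ← intervalIntegral_integral_swap]
  · rw [mul_assoc, ← intervalIntegral.integral_mul_const]
    congr 1
    refine intervalIntegral.integral_congr fun φ _ => ?_
    exact h _ (by simp [Complex.norm_exp_ofReal_mul_I])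
  · have : IsFiniteMeasure ((volume.restrict (Set.uIoc (-Real.pi) Real.pi)).prod μ) := by
      have : IsFiniteMeasure (volume.restrict (Set.uIoc (-Real.pi) Real.pi)) :=
        ⟨by simp [Set.uIoc]⟩
      infer_instance
    refine Integrable.of_bound (C := 1) ?_ ?_
    · refine Measurable.aestronglyMeasurable ?_
      simp only [Function.uncurry_def]
      fun_prop
    · exact Eventually.of_forall fun ω => by simpa [Function.uncurry] using Real.abs_cos_le_one _

end CharFun

/-! ### The complex kernel as a mean over a disc. -/

section JOneKernel

theorem integral_closedBall_exp_inner_complex (w : ℂ) :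
    ∫ z in Metric.closedBall (0 : ℂ) discRadius, Complex.exp ((inner ℝ w z : ℝ) * Complex.I) =
      (jOne (discRadius * ‖w‖) : ℂ) := by
  rw [integral_closedBall_exp_inner, integral_closedBall_cos_inner]

theorem jOne_abs (t : ℝ) : jOne |t| = jOne t := by
  rcases abs_cases t with ⟨h, _⟩ | ⟨h, _⟩ <;> simp [h, jOne_neg]

theorem isFiniteMeasure_restrict_closedBall {E : Type*} [NormedAddCommGroup E]
    [InnerProductSpace ℝ E] [FiniteDimensional ℝ E] [MeasurableSpace E] [BorelSpace E] (r : ℝ) :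
    IsFiniteMeasure ((volume : Measure E).restrict (Metric.closedBall 0 r)) :=
  ⟨by rw [Measure.restrict_apply_univ]; exact measure_closedBall_lt_top⟩

/-- At every frequency of length |s|/α, `jOne (b * s)` is the characteristic function of `b • z` for
z uniform in the disc. The mean absorbs it into a single J₀. -/
theorem jOne_mul_besselJ_zero (b s : ℝ) (y : ℂ) :
    jOne (b * s) * besselJ 0 (s / discRadius * ‖y‖) =
      ∫ z in Metric.closedBall (0 : ℂ) discRadius, besselJ 0 (s / discRadius * ‖y + b • z‖) := by
  have := isFiniteMeasure_restrict_closedBall (E := ℂ) discRadius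
  have hα := discRadius_pos
  rw [integral_besselJ_zero_norm_add (X := fun z : ℂ => b • z) (by fun_prop) (c := jOne (b * s)),
    mul_comm]
  intro w hw
  refine integral_cos_inner_add (X := fun z : ℂ => b • z) (by fun_prop) ?_ y
  simp_rw [real_inner_smul_right, ← real_inner_smul_left]
  rw [integral_closedBall_exp_inner_complex, norm_smul, hw, Real.norm_eq_abs, abs_div,
    abs_of_pos hα, ← jOne_abs (b * s), abs_mul]
  congr 2
  field_simp

/-- The radial function `∫₀ᴿ s J₀(β s r) ds` in closed form. -/
theorem mul_integral_besselJ_zero {β : ℝ} (hβ : β ≠ 0) {r : ℝ} (R : ℝ) :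
    r * ∫ s in (0 : ℝ)..R, besselJ 0 (s * β * r) * s = R / β * besselJ 1 (β * R * r) := by
  by_cases hr : r = 0
  · subst hr
    have : besselJ 1 0 = 0 := by rw [besselJ_one_eq_jOne]; simp
    simp [this]
  · have h1 : ∀ s : ℝ, besselJ 0 (s * β * r) * s =
        (β * r)⁻¹ * (fun t => t * besselJ 0 t) (s * (β * r)) := by
      intro s; rw [← mul_assoc s]; field_simp
    simp_rw [h1]
    rw [intervalIntegral.integral_const_mul,
      intervalIntegral.integral_comp_mul_right (fun t => t * besselJ 0 t) (by positivity), zero_mul,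
      integral_id_mul_besselJ_zero, smul_eq_mul, show β * R * r = R * (β * r) by ring]
    field_simp

theorem integral_mul_besselJ_one {β : ℝ} (hβ : β ≠ 0) (R r₁ r₂ : ℝ) :
    ∫ r in r₁..r₂, R / β * besselJ 1 (β * R * r) =
      (β ^ 2)⁻¹ * (besselJ 0 (β * R * r₁) - besselJ 0 (β * R * r₂)) := by
  by_cases hR : R = 0
  · simp [hR]
  · have hI : ∀ a b, IntervalIntegrable (besselJ 1) volume a b :=
      fun a b => (continuous_besselJ 1).intervalIntegrable _ _
    rw [intervalIntegral.integral_const_mul, intervalIntegral.integral_comp_mul_left _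
      (by positivity), ← intervalIntegral.integral_add_adjacent_intervals (hI _ 0) (hI 0 _),
      intervalIntegral.integral_symm, integral_besselJ_one, integral_besselJ_one, smul_eq_mul]
    field_simp
    ring

end JOneKernel

/-! ### Intersections of rays with a disc. -/

section RayEnds

/-- The ray from the origin at angle `φ` meets the disc of radius `ρ` about `y` for parameters
between `rayEntry ρ y φ` and `rayExit ρ y φ`; the two agree if the intersection is empty. -/
noncomputable def rayEntry (ρ y φ : ℝ) : ℝ :=
  max 0 (y * Real.cos φ - Real.sqrt (ρ ^ 2 - y ^ 2 + (y * Real.cos φ) ^ 2))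

/-- See `rayEntry`. -/
noncomputable def rayExit (ρ y φ : ℝ) : ℝ :=
  max 0 (y * Real.cos φ + Real.sqrt (ρ ^ 2 - y ^ 2 + (y * Real.cos φ) ^ 2))

theorem rayEntry_nonneg (ρ y φ : ℝ) : 0 ≤ rayEntry ρ y φ := le_max_left _ _

theorem rayEntry_le_rayExit (ρ y φ : ℝ) : rayEntry ρ y φ ≤ rayExit ρ y φ := by
  refine max_le_max le_rfl ?_
  linarith [Real.sqrt_nonneg (ρ ^ 2 - y ^ 2 + (y * Real.cos φ) ^ 2)]

theorem mem_closedBall_ray_iff {ρ : ℝ} (hρ : 0 ≤ ρ) (y φ r : ℝ) :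
    (r * Complex.exp (φ * Complex.I) : ℂ) ∈ Metric.closedBall (y : ℂ) ρ ↔
      (r - y * Real.cos φ) ^ 2 ≤ ρ ^ 2 - y ^ 2 + (y * Real.cos φ) ^ 2 := by
  have h : ‖(r * Complex.exp (φ * Complex.I) : ℂ) - y‖ ^ 2 =
      r ^ 2 - 2 * r * y * Real.cos φ + y ^ 2 := by
    rw [← Complex.normSq_eq_norm_sq, Complex.normSq_apply]
    simp only [Complex.sub_re, Complex.sub_im, Complex.re_ofReal_mul, Complex.im_ofReal_mul,
      Complex.exp_ofReal_mul_I_re, Complex.exp_ofReal_mul_I_im, Complex.ofReal_re,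
      Complex.ofReal_im]
    linear_combination r ^ 2 * Real.sin_sq_add_cos_sq φ
  rw [mem_closedBall_iff_norm, ← sq_le_sq₀ (norm_nonneg _) hρ, h]
  constructor <;> intro h' <;> nlinarith

theorem ray_inter_ae_eq {ρ y : ℝ} (hρ : 0 ≤ ρ) (hy : 0 ≤ y) (φ : ℝ) :
    (Set.Ioc 0 (y + ρ) ∩ {r : ℝ | (r * Complex.exp (φ * Complex.I) : ℂ) ∈
      Metric.closedBall (y : ℂ) ρ} : Set ℝ) =ᵐ[volume]
      Set.Ioc (rayEntry ρ y φ) (rayExit ρ y φ) := by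
  have hM : ∀ r : ℝ, (r * Complex.exp (φ * Complex.I) : ℂ) ∈ Metric.closedBall (y : ℂ) ρ →
      r ≤ y + ρ := by
    intro r hr
    rw [mem_closedBall_iff_norm] at hr
    have h1 := norm_sub_norm_le (r * Complex.exp (φ * Complex.I) : ℂ) y
    rw [norm_mul, Complex.norm_exp_ofReal_mul_I, mul_one, Complex.norm_real, Complex.norm_real,
      Real.norm_eq_abs, Real.norm_eq_abs, abs_of_nonneg hy] at h1
    linarith [le_abs_self r]
  set c := y * Real.cos φ with hc
  set D := ρ ^ 2 - y ^ 2 + c ^ 2 with hD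
  have hs : (Set.Ioc 0 (y + ρ) ∩ {r : ℝ | (r * Complex.exp (φ * Complex.I) : ℂ) ∈
      Metric.closedBall (y : ℂ) ρ} : Set ℝ) = Set.Ioi 0 ∩ {r | (r - c) ^ 2 ≤ D} := by
    ext r
    simp only [Set.mem_inter_iff, Set.mem_Ioc, Set.mem_ofPred_eq, Set.mem_Ioi]
    rw [mem_closedBall_ray_iff hρ, ← hc, ← hD]
    constructor
    · rintro ⟨⟨h1, _⟩, h2⟩; exact ⟨h1, h2⟩
    · rintro ⟨h1, h2⟩
      exact ⟨⟨h1, hM r ((mem_closedBall_ray_iff hρ y φ r).2 h2)⟩, h2⟩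
  rw [hs, rayEntry, rayExit, ← hc, ← hD]
  by_cases hD0 : 0 ≤ D
  · have h1 : {r | (r - c) ^ 2 ≤ D} = Set.Icc (c - Real.sqrt D) (c + Real.sqrt D) := by
      ext r
      rw [Set.mem_ofPred_eq, Set.mem_Icc, Real.sq_le hD0]
      constructor <;> rintro ⟨h1, h2⟩ <;> constructor <;> linarith
    have h2 : (Set.Ioi 0 ∩ Set.Ioc (c - Real.sqrt D) (c + Real.sqrt D) : Set ℝ) =
        Set.Ioc (max 0 (c - Real.sqrt D)) (max 0 (c + Real.sqrt D)) := by
      ext r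
      simp only [Set.mem_inter_iff, Set.mem_Ioi, Set.mem_Ioc, max_lt_iff, le_max_iff]
      constructor
      · rintro ⟨h1, h2, h3⟩; exact ⟨⟨h1, h2⟩, Or.inr h3⟩
      · rintro ⟨⟨h1, h2⟩, h3 | h3⟩
        · linarith
        · exact ⟨h1, h2, h3⟩
    rw [h1, ← h2]
    exact (ae_eq_refl _).inter Ioc_ae_eq_Icc.symm
  · have h1 : {r | (r - c) ^ 2 ≤ D} = ∅ := by
      ext r
      simp only [Set.mem_ofPred_eq, Set.mem_empty_iff_false, iff_false]
      nlinarith [sq_nonneg (r - c)]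
    -- If the ray's line misses the disc, the square root of the negative discriminant is read as 0,
    -- so entry and exit coincide.
    rw [h1, Real.sqrt_eq_zero'.2 (le_of_not_ge hD0)]
    simp

end RayEnds

/-! ### The limit of the complex kernel. -/

section JOneKernel

/-- The kernel of the complex case, written as an integral over the directions. -/
theorem integral_jOne_mul_besselJ_zero {b y : ℝ} (hb : b ≠ 0) (hy : 0 ≤ y) (R : ℝ) :
    ∫ s in (0 : ℝ)..R, jOne (b * s) * besselJ 0 (s / discRadius * y) * s =
      (Real.pi * b ^ 2)⁻¹ * ∫ φ in (-Real.pi)..Real.pi,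
        (besselJ 0 (discRadius⁻¹ * R * rayEntry (|b| * discRadius) y φ) -
          besselJ 0 (discRadius⁻¹ * R * rayExit (|b| * discRadius) y φ)) := by
  have hα := discRadius_pos
  have hfin := isFiniteMeasure_restrict_closedBall (E := ℂ) discRadius
  have hβ : discRadius⁻¹ ≠ 0 := inv_ne_zero hα.ne'
  have hJ := continuous_besselJ 0
  set ρ := |b| * discRadius with hρ
  have hρ0 : 0 ≤ ρ := by positivity
  let H : ℝ → ℝ := fun r => ∫ s in (0 : ℝ)..R, besselJ 0 (s * discRadius⁻¹ * r) * s
  have hH : Continuous H := by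
    refine intervalIntegral.continuous_parametric_intervalIntegral_of_continuous' ?_ _ _
    simp only [Function.uncurry_def]; fun_prop
  -- After the product is replaced by a mean of J₀, the s-integral goes inside and becomes the
  -- radial function `H`.
  have h1 : ∫ s in (0 : ℝ)..R, jOne (b * s) * besselJ 0 (s / discRadius * y) * s =
      ∫ z in Metric.closedBall (0 : ℂ) discRadius, H ‖(y : ℂ) + b • z‖ := by
    have e : ∀ s : ℝ, jOne (b * s) * besselJ 0 (s / discRadius * y) * s =
        ∫ z in Metric.closedBall (0 : ℂ) discRadius,
          besselJ 0 (s * discRadius⁻¹ * ‖(y : ℂ) + b • z‖) * s := by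
      intro s
      have := jOne_mul_besselJ_zero b s (y : ℂ)
      rw [Complex.norm_real, Real.norm_eq_abs, abs_of_nonneg hy] at this
      rw [this, ← integral_mul_const]
      simp only [div_eq_mul_inv]
    simp_rw [e]
    rw [intervalIntegral_integral_swap]
    have hc : Continuous (Function.uncurry fun (s : ℝ) (z : ℂ) =>
        besselJ 0 (s * discRadius⁻¹ * ‖(y : ℂ) + b • z‖) * s) := by
      simp only [Function.uncurry_def]; fun_prop
    rw [Measure.prod_restrict, ← Measure.volume_eq_prod]
    exact (hc.continuousOn.integrableOn_compact
      (isCompact_uIcc.prod (isCompact_closedBall _ _))).mono_set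
      (Set.prod_mono Set.uIoc_subset_uIcc subset_rfl)
  -- The map z ↦ y + bz carries the disc onto the disc of radius ρ about y, which places the
  -- singular direction set of `H` at the origin of polar coordinates.
  have h2 : ∫ z in Metric.closedBall (0 : ℂ) discRadius, H ‖(y : ℂ) + b • z‖ =
      (b ^ 2)⁻¹ * ∫ z in Metric.closedBall (y : ℂ) ρ, H ‖z‖ := by
    rw [← integral_indicator measurableSet_closedBall, ← integral_indicator measurableSet_closedBall]
    have e : ∀ z : ℂ, (Metric.closedBall (0 : ℂ) discRadius).indicator
        (fun z => H ‖(y : ℂ) + b • z‖) z =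
        (fun v => (Metric.closedBall (y : ℂ) ρ).indicator (fun z => H ‖z‖) (y + v)) (b • z) := by
      intro z
      have hm : z ∈ Metric.closedBall (0 : ℂ) discRadius ↔
          (y : ℂ) + b • z ∈ Metric.closedBall (y : ℂ) ρ := by
        rw [mem_closedBall_zero_iff, mem_closedBall_iff_norm, add_sub_cancel_left, norm_smul, hρ,
          Real.norm_eq_abs]
        exact (mul_le_mul_iff_right₀ (abs_pos.2 hb)).symm
      by_cases hz : z ∈ Metric.closedBall (0 : ℂ) discRadius
      · simp only [Set.indicator_of_mem hz, Set.indicator_of_mem (hm.1 hz)]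
      · simp only [Set.indicator_of_notMem hz, Set.indicator_of_notMem (mt hm.2 hz)]
    simp_rw [e]
    rw [Measure.integral_comp_smul volume
      (fun v => (Metric.closedBall (y : ℂ) ρ).indicator (fun z => H ‖z‖) (y + v)),
      integral_add_left_eq_self (fun z => (Metric.closedBall (y : ℂ) ρ).indicator (fun z => H ‖z‖) z)]
    rw [Complex.finrank_real_complex, abs_inv, abs_of_pos (by positivity), smul_eq_mul]
  have hsub : Metric.closedBall (y : ℂ) ρ ⊆ Metric.closedBall 0 (y + ρ) := by
    refine Metric.closedBall_subset_closedBall' ?_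
    rw [dist_zero_right, Complex.norm_real, Real.norm_eq_abs, abs_of_nonneg hy, add_comm]
  have hπ : (discRadius⁻¹) ^ 2 = Real.pi := by
    rw [inv_pow]
    exact inv_eq_of_mul_eq_one_left pi_mul_discRadius_sq
  rw [h1, h2, setIntegral_eq_polar (G := fun z => H ‖z‖) measurableSet_closedBall
      (hH.comp continuous_norm) hsub,
    mul_inv, mul_comm Real.pi⁻¹, mul_assoc, ← intervalIntegral.integral_const_mul Real.pi⁻¹]
  congr 1
  refine intervalIntegral.integral_congr fun φ _ => ?_
  have hmeas : MeasurableSet {r : ℝ | (r * Complex.exp (φ * Complex.I) : ℂ) ∈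
      Metric.closedBall (y : ℂ) ρ} := by
    have : Continuous fun r : ℝ => (r * Complex.exp (φ * Complex.I) : ℂ) := by fun_prop
    exact this.measurable measurableSet_closedBall
  -- Along a ray, r H(r) = (R/β) J₁(βRr) is the derivative of -J₀(βRr)/β², with β = 1/α and β² = π.
  -- Hence only the two ends of the chord contribute.
  rw [setIntegral_indicator hmeas, setIntegral_congr_set (ray_inter_ae_eq hρ0 hy φ),
    ← intervalIntegral.integral_of_le (rayEntry_le_rayExit _ _ _), ← hπ,
    ← integral_mul_besselJ_one hβ]
  refine intervalIntegral.integral_congr fun r hr => ?_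
  rw [Set.uIcc_of_le (rayEntry_le_rayExit _ _ _)] at hr
  have hr0 : 0 ≤ r := (rayEntry_nonneg _ _ _).trans hr.1
  simp only [norm_mul, Complex.norm_exp_ofReal_mul_I, mul_one,
    Complex.norm_real, Real.norm_eq_abs, abs_of_nonneg hr0]
  exact mul_integral_besselJ_zero hβ R

/-- Each J₀ is at most 1 in absolute value, so the integral over the directions is at most 4π,
independently of `y` and `R`. -/
theorem abs_integral_jOne_mul_besselJ_zero_le {b y : ℝ} (hb : b ≠ 0) (hy : 0 ≤ y) (R : ℝ) :
    |∫ s in (0 : ℝ)..R, jOne (b * s) * besselJ 0 (s / discRadius * y) * s| ≤ 4 / b ^ 2 := by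
  rw [integral_jOne_mul_besselJ_zero hb hy]
  have h := intervalIntegral.norm_integral_le_of_norm_le_const (a := -Real.pi) (b := Real.pi)
    (C := 2) (f := fun φ => besselJ 0 (discRadius⁻¹ * R * rayEntry (|b| * discRadius) y φ) -
          besselJ 0 (discRadius⁻¹ * R * rayExit (|b| * discRadius) y φ)) (fun φ _ => by
      refine (norm_sub_le _ _).trans ?_
      have h1 := abs_besselJ_zero_le_one (discRadius⁻¹ * R * rayEntry (|b| * discRadius) y φ)
      have h2 := abs_besselJ_zero_le_one (discRadius⁻¹ * R * rayExit (|b| * discRadius) y φ)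
      rw [Real.norm_eq_abs, Real.norm_eq_abs]
      linarith)
  have hpi := Real.pi_pos
  rw [sub_neg_eq_add, abs_of_pos (by positivity : 0 < Real.pi + Real.pi), Real.norm_eq_abs] at h
  rw [abs_mul, abs_inv, abs_of_pos (by positivity)]
  calc _ ≤ (Real.pi * b ^ 2)⁻¹ * (2 * (Real.pi + Real.pi)) := by gcongr
    _ = _ := by field_simp; norm_num

theorem tendsto_besselJ_zero_mul {β r : ℝ} (hβ : 0 < β) (hr : 0 ≤ r) :
    Tendsto (fun R => besselJ 0 (β * R * r)) atTop (𝓝 (if r = 0 then 1 else 0)) := by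
  split_ifs with h
  · subst h; simp [besselJ_zero_zero]
  · have hr' : 0 < r := lt_of_le_of_ne hr (Ne.symm h)
    refine tendsto_besselJ_zero_atTop.comp ?_
    exact (tendsto_id.const_mul_atTop hβ).atTop_mul_const hr'

theorem integral_ite_cos_pos :
    ∫ φ in (-Real.pi)..Real.pi, (if 0 < Real.cos φ then (1 : ℝ) else 0) = Real.pi := by
  have hpi := Real.pi_pos
  rw [intervalIntegral.integral_of_le (by linarith)]
  have h : ∀ φ ∈ Set.Ioc (-Real.pi) Real.pi, (if 0 < Real.cos φ then (1 : ℝ) else 0) =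
      (Set.Ioo (-(Real.pi / 2)) (Real.pi / 2)).indicator (fun _ => (1 : ℝ)) φ := by
    intro φ hφ
    by_cases hm : φ ∈ Set.Ioo (-(Real.pi / 2)) (Real.pi / 2)
    · rw [Set.indicator_of_mem hm, if_pos (Real.cos_pos_of_mem_Ioo hm)]
    · rw [Set.indicator_of_notMem hm, if_neg]
      rw [not_lt]
      by_cases h1 : φ < Real.pi / 2
      · have h2 : φ ≤ -(Real.pi / 2) := by
          by_contra h2
          exact hm ⟨not_le.1 h2, h1⟩
        rw [← Real.cos_neg]
        exact Real.cos_nonpos_of_pi_div_two_le_of_le (by linarith) (by linarith [hφ.1])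
      · exact Real.cos_nonpos_of_pi_div_two_le_of_le (not_lt.1 h1) (by linarith [hφ.2])
  have hsub : Set.Ioo (-(Real.pi / 2)) (Real.pi / 2) ⊆ Set.Ioc (-Real.pi) Real.pi :=
    fun φ hφ => ⟨by linarith [hφ.1], by linarith [hφ.2]⟩
  rw [setIntegral_congr_fun measurableSet_Ioc h, setIntegral_indicator measurableSet_Ioo,
    Set.inter_eq_self_of_subset_right hsub]
  simp only [integral_const, smul_eq_mul, mul_one, measureReal_restrict_apply_univ,
    Real.volume_real_Ioo]
  rw [max_eq_left (by linarith)]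
  ring

/-- In the limit a direction counts precisely if its ray enters at 0 and exits later. With the
origin inside the disc this holds for all directions, on the circle for the half with cos φ > 0, and
outside for none. -/
theorem integral_ray_limit {ρ y : ℝ} (hρ : 0 < ρ) (hy : 0 ≤ y) :
    ∫ φ in (-Real.pi)..Real.pi, ((if rayEntry ρ y φ = 0 then (1 : ℝ) else 0) -
      (if rayExit ρ y φ = 0 then 1 else 0)) = 2 * Real.pi * halfIndicator ρ y := by
  unfold halfIndicator
  have hE : ∀ x : ℝ, max 0 x = 0 ↔ x ≤ 0 := fun x => max_eq_left_iff
  simp only [rayEntry, rayExit, hE]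
  rcases lt_trichotomy y ρ with h | h | h
  · rw [if_pos h]
    have h1 : ∀ φ : ℝ, ((if y * Real.cos φ - Real.sqrt (ρ ^ 2 - y ^ 2 + (y * Real.cos φ) ^ 2) ≤ 0
        then (1 : ℝ) else 0) - (if y * Real.cos φ +
        Real.sqrt (ρ ^ 2 - y ^ 2 + (y * Real.cos φ) ^ 2) ≤ 0 then 1 else 0)) = 1 := by
      intro φ
      have h2 : |y * Real.cos φ| < Real.sqrt (ρ ^ 2 - y ^ 2 + (y * Real.cos φ) ^ 2) := by
        rw [Real.lt_sqrt (abs_nonneg _), sq_abs]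
        nlinarith
      rw [abs_lt] at h2
      rw [if_pos (by linarith [h2.2]), if_neg (by linarith [h2.1]), sub_zero]
    simp_rw [h1]
    simp
    ring
  · rw [if_neg h.not_lt, if_pos h]
    have h1 : ∀ φ : ℝ, ((if y * Real.cos φ - Real.sqrt (ρ ^ 2 - y ^ 2 + (y * Real.cos φ) ^ 2) ≤ 0
        then (1 : ℝ) else 0) - (if y * Real.cos φ +
        Real.sqrt (ρ ^ 2 - y ^ 2 + (y * Real.cos φ) ^ 2) ≤ 0 then 1 else 0)) =
        if 0 < Real.cos φ then 1 else 0 := by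
      intro φ
      rw [h, sub_self, zero_add, Real.sqrt_sq_eq_abs, if_pos (by linarith [le_abs_self (ρ * Real.cos φ)])]
      by_cases hc : 0 < Real.cos φ
      · rw [if_pos hc, if_neg, sub_zero]
        have := mul_pos hρ hc
        linarith [abs_nonneg (ρ * Real.cos φ)]
      · rw [if_neg hc, if_pos, sub_self]
        rw [abs_of_nonpos (mul_nonpos_of_nonneg_of_nonpos hρ.le (not_lt.1 hc))]
        linarith
    simp_rw [h1]
    rw [integral_ite_cos_pos]
    ring
  · rw [if_neg h.not_gt, if_neg h.ne']
    have h1 : ∀ φ : ℝ, ((if y * Real.cos φ - Real.sqrt (ρ ^ 2 - y ^ 2 + (y * Real.cos φ) ^ 2) ≤ 0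
        then (1 : ℝ) else 0) - (if y * Real.cos φ +
        Real.sqrt (ρ ^ 2 - y ^ 2 + (y * Real.cos φ) ^ 2) ≤ 0 then 1 else 0)) = 0 := by
      intro φ
      by_cases hc : y * Real.cos φ = 0
      · rw [hc, Real.sqrt_eq_zero'.2 (by nlinarith)]
        simp
      have h2 : Real.sqrt (ρ ^ 2 - y ^ 2 + (y * Real.cos φ) ^ 2) < |y * Real.cos φ| := by
        rw [Real.sqrt_lt' (abs_pos.2 hc), sq_abs]
        nlinarith
      have h3 := Real.sqrt_nonneg (ρ ^ 2 - y ^ 2 + (y * Real.cos φ) ^ 2)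
      rcases abs_cases (y * Real.cos φ) with ⟨e, _⟩ | ⟨e, _⟩ <;> rw [e] at h2
      · rw [if_neg (by linarith), if_neg (by linarith), sub_zero]
      · rw [if_pos (by linarith), if_pos (by linarith), sub_self]
    simp_rw [h1]
    simp

/-- J₀(R r/α) tends to 0 for r > 0 and is 1 for r = 0; dominated convergence over the directions
reduces the claim to `integral_ray_limit`. -/
theorem tendsto_integral_jOne_mul_besselJ_zero {b y : ℝ} (hb : b ≠ 0) (hy : 0 ≤ y) :
    Tendsto (fun R => ∫ s in (0 : ℝ)..R, jOne (b * s) * besselJ 0 (s / discRadius * y) * s) atTop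
      (𝓝 (2 / b ^ 2 * halfIndicator (|b| * discRadius) y)) := by
  have hα := discRadius_pos
  have hJ := continuous_besselJ 0
  simp_rw [integral_jOne_mul_besselJ_zero hb hy]
  have h : Tendsto (fun R => ∫ φ in (-Real.pi)..Real.pi,
        (besselJ 0 (discRadius⁻¹ * R * rayEntry (|b| * discRadius) y φ) -
          besselJ 0 (discRadius⁻¹ * R * rayExit (|b| * discRadius) y φ))) atTop
      (𝓝 (2 * Real.pi * halfIndicator (|b| * discRadius) y)) := by
    rw [← integral_ray_limit (by positivity) hy]
    refine intervalIntegral.tendsto_integral_filter_of_dominated_convergence (fun _ => 2) ?_ ?_ ?_ ?_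
    · refine Eventually.of_forall fun R => ?_
      refine Continuous.aestronglyMeasurable ?_
      unfold rayEntry rayExit
      fun_prop
    · refine Eventually.of_forall fun R => Eventually.of_forall fun φ _ => ?_
      refine (norm_sub_le _ _).trans ?_
      have h1 := abs_besselJ_zero_le_one (discRadius⁻¹ * R * rayEntry (|b| * discRadius) y φ)
      have h2 := abs_besselJ_zero_le_one (discRadius⁻¹ * R * rayExit (|b| * discRadius) y φ)
      rw [Real.norm_eq_abs, Real.norm_eq_abs]
      linarith
    · exact intervalIntegrable_const
    · refine Eventually.of_forall fun φ _ => ?_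
      exact (tendsto_besselJ_zero_mul (inv_pos.2 hα) (rayEntry_nonneg _ _ _)).sub
        (tendsto_besselJ_zero_mul (inv_pos.2 hα)
          ((rayEntry_nonneg _ _ _).trans (rayEntry_le_rayExit _ _ _)))
  refine (h.const_mul (Real.pi * b ^ 2)⁻¹).trans_eq ?_
  congr 1
  have := Real.pi_ne_zero
  field_simp

end JOneKernel

/-! ### From kernels to improper integrals. -/

section Expectation

theorem halfIndicator_eq (ρ t : ℝ) :
    halfIndicator ρ t = (Set.Iic ρ).indicator (fun _ => (1 : ℝ)) t -
      1 / 2 * ({ρ} : Set ℝ).indicator (fun _ => (1 : ℝ)) t := by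
  unfold halfIndicator
  rcases lt_trichotomy t ρ with h | h | h
  · simp [Set.indicator, h, h.le, h.ne]
  · subst h; simp [Set.indicator]; norm_num
  · simp [Set.indicator, h.not_gt, h.not_ge, h.ne']

variable {Ω : Type*} [MeasurableSpace Ω] {P : Measure Ω} [IsFiniteMeasure P]

theorem integral_halfIndicator {N : Ω → ℝ} (hN : Measurable N) (ρ : ℝ) :
    ∫ ω, halfIndicator ρ (N ω) ∂P = P.real {ω | N ω ≤ ρ} - 1 / 2 * P.real {ω | N ω = ρ} := by
  have h1 : ∀ ω, halfIndicator ρ (N ω) = {ω | N ω ≤ ρ}.indicator (fun _ => (1 : ℝ)) ω -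
      1 / 2 * {ω | N ω = ρ}.indicator (fun _ => (1 : ℝ)) ω := fun ω => halfIndicator_eq ρ (N ω)
  have m1 : MeasurableSet {ω | N ω ≤ ρ} := measurableSet_le hN measurable_const
  have m2 : MeasurableSet {ω | N ω = ρ} := hN (measurableSet_singleton ρ)
  simp_rw [h1]
  rw [integral_sub ((integrable_const _).indicator m1)
    (((integrable_const _).indicator m2).const_mul _), integral_const_mul,
    integral_indicator_const _ m1, integral_indicator_const _ m2]
  simp

/-- The improper integral of a mean value of kernels that converge boundedly to a multiple of
`halfIndicator`. -/
theorem hasImproperIntegral_of_kernel {f q : ℝ → ℝ} {Φ : ℝ → ℝ → ℝ} {N : Ω → ℝ} {C c ρ : ℝ}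
    (hf : Continuous f) (hq : Continuous q) (hΦ : Continuous (Function.uncurry Φ))
    (hΦ1 : ∀ s y, |Φ s y| ≤ 1) (hN : Measurable N)
    (hfe : ∀ s, f s = q s * ∫ ω, Φ s (N ω) ∂P)
    (hbound : ∀ ω R, |∫ s in (0 : ℝ)..R, q s * Φ s (N ω)| ≤ C)
    (hlim : ∀ ω, Tendsto (fun R => ∫ s in (0 : ℝ)..R, q s * Φ s (N ω)) atTop
      (𝓝 (c * halfIndicator ρ (N ω)))) :
    HasImproperIntegral f
      (c * (P.real {ω | N ω ≤ ρ} - 1 / 2 * P.real {ω | N ω = ρ})) := by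
  refine ⟨fun R => hf.intervalIntegrable _ _, ?_⟩
  have hswap : ∀ R, ∫ s in (0 : ℝ)..R, f s =
      ∫ ω, (∫ s in (0 : ℝ)..R, q s * Φ s (N ω)) ∂P := by
    intro R
    simp_rw [hfe, ← integral_const_mul]
    refine intervalIntegral_integral_swap ?_
    have hqi : Integrable q (volume.restrict (Set.uIoc 0 R)) :=
      (hq.continuousOn.integrableOn_compact isCompact_uIcc).mono_set Set.uIoc_subset_uIcc
    refine Integrable.mono' (hqi.norm.comp_fst P) ?_ (Eventually.of_forall fun p => ?_)
    · refine Measurable.aestronglyMeasurable ?_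
      exact (hq.measurable.comp measurable_fst).mul
        (hΦ.measurable.comp (measurable_fst.prodMk (hN.comp measurable_snd)))
    · simp only [Function.uncurry, norm_mul]
      exact mul_le_of_le_one_right (norm_nonneg _) (hΦ1 _ _)
  simp_rw [hswap]
  rw [← integral_halfIndicator hN, ← integral_const_mul]
  refine tendsto_integral_filter_of_dominated_convergence (fun _ => C)
    (Eventually.of_forall fun R => ?_)
    (Eventually.of_forall fun R => Eventually.of_forall fun ω => hbound ω R) (integrable_const _)
    (Eventually.of_forall hlim)
  -- Measurability of the integrand in ω: the truncated kernel is continuous in y.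
  have hK : Continuous fun y => ∫ s in (0 : ℝ)..R, q s * Φ s y := by
    refine intervalIntegral.continuous_parametric_intervalIntegral_of_continuous' ?_ _ _
    simp only [Function.uncurry_def] at hΦ ⊢
    exact (hq.comp continuous_snd).mul (hΦ.comp (continuous_snd.prodMk continuous_fst))
  exact (hK.measurable.comp hN).aestronglyMeasurable

end Expectation

/-! ### The improper integrals as slab measures. -/

section SectionIntegrals

/-- The product of the volumes restricted to the ball of radius `α`. -/
noncomputable abbrev ballProd (E κ : Type*) [NormedAddCommGroup E] [MeasureSpace E] [Fintype κ]
    (α : ℝ) : Measure (κ → E) :=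
  Measure.pi fun _ : κ => (volume : Measure E).restrict (Metric.closedBall 0 α)

theorem integral_closedBall_exp_inner_real (w : ℝ) :
    ∫ z in Metric.closedBall (0 : ℝ) (1 / 2), Complex.exp ((inner ℝ w z : ℝ) * Complex.I) =
      (Real.sinc (‖w‖ / 2) : ℂ) := by
  rw [integral_closedBall_exp_inner]
  congr 1
  have hi : ∀ z : ℝ, Real.cos (inner ℝ w z) = Real.cos (w * z) := by
    intro z
    simp [mul_comm]
  simp_rw [hi]
  rw [Real.closedBall_eq_Icc, integral_Icc_eq_integral_Ioc,
    ← intervalIntegral.integral_of_le (by norm_num)]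
  by_cases hw : w = 0
  · subst hw; norm_num
  · rw [intervalIntegral.integral_comp_mul_left _ hw, integral_cos]
    have h0 : ‖w‖ / 2 ≠ 0 := by simpa using hw
    rw [Real.sinc_of_ne_zero h0]
    rcases abs_cases w with ⟨h, _⟩ | ⟨h, _⟩ <;> rw [Real.norm_eq_abs, h] <;>
      norm_num [mul_neg, Real.sin_neg, neg_div] <;> field_simp <;> ring

variable {ι : Type*} [Fintype ι] [DecidableEq ι] {a : ι → ℝ} {k m : ι}

theorem isFiniteMeasure_ballProd (E κ : Type*) [NormedAddCommGroup E] [InnerProductSpace ℝ E]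
    [FiniteDimensional ℝ E] [MeasurableSpace E] [BorelSpace E] [Fintype κ] (α : ℝ) :
    IsFiniteMeasure (ballProd E κ α) := by
  have := isFiniteMeasure_restrict_closedBall (E := E) α
  infer_instance

/-- The half-weighted measure of the points `z` of a product of balls for which
`a k • u + ∑ j, a j • z j` has norm at most `ρ`. -/
noncomputable def slabMeasure {E : Type*} [NormedAddCommGroup E] [InnerProductSpace ℝ E]
    [MeasureSpace E] (α : ℝ) (a : ι → ℝ) (k m : ι) (u : E) : ℝ :=
  (ballProd E (Others k m) α).real
      {z | ‖a k • u + ∑ j : Others k m, a j • z j‖ ≤ |a m| * α} -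
    1 / 2 * (ballProd E (Others k m) α).real
      {z | ‖a k • u + ∑ j : Others k m, a j • z j‖ = |a m| * α}

/-- The factor with index m serves as the kernel. The frequency is 2s because the interval [-1/2,
1/2] has characteristic function sinc(w/2); the shift a_k/2 then yields cos(a_k s). -/
theorem hasImproperIntegral_sinc (hkm : k ≠ m) (ham : a m ≠ 0) :
    HasImproperIntegral
      (fun s => (∏ j ∈ Finset.univ.erase k, Real.sinc (a j * s)) * Real.cos (a k * s))
      (Real.pi / (2 * |a m|) * slabMeasure (1 / 2) a k m (1 / 2 : ℝ)) := by
  have hfinB := isFiniteMeasure_restrict_closedBall (E := ℝ) (1 / 2)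
  have hfin := isFiniteMeasure_ballProd ℝ (Others k m) (1 / 2)
  have hsc := Real.continuous_sinc
  refine hasImproperIntegral_of_kernel (q := fun s => Real.sinc (a m * s))
    (Φ := fun s y => Real.cos (2 * s * y)) (C := 4 / |a m|) (ρ := |a m| * (1 / 2))
    (N := fun z : Others k m → ℝ => ‖a k • (1 / 2 : ℝ) + ∑ j : Others k m, a j • z j‖)
    ?_ (by fun_prop) ?_ (fun _ _ => Real.abs_cos_le_one _) (by fun_prop) ?_
    (fun z R => abs_integral_sinc_mul_cos_le ham _ _) (fun z => ?_)
  · fun_prop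
  · simp only [Function.uncurry_def]; fun_prop
  · intro s
    rw [prod_erase_eq_mul_prod_others hkm, mul_assoc]
    congr 1
    have h := integral_cos_inner_add (μ := ballProd ℝ (Others k m) (1 / 2))
      (X := fun z : Others k m → ℝ => ∑ j : Others k m, a j • z j) (by fun_prop)
      (integral_pi_exp_inner_sum _ (g := fun t => Real.sinc (t / 2))
        integral_closedBall_exp_inner_real (fun j : Others k m => a j) (2 * s))
      (a k • (1 / 2 : ℝ))
    have e1 : ∀ y : ℝ, Real.cos (2 * s * ‖y‖) = Real.cos (inner ℝ (2 * s) y) := by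
      intro y
      have : (inner ℝ (2 * s) y : ℝ) = 2 * s * y := by simp [mul_comm]
      rw [this]
      rcases abs_cases y with ⟨h, _⟩ | ⟨h, _⟩ <;> rw [Real.norm_eq_abs, h]
      rw [mul_neg, Real.cos_neg]
    simp_rw [e1]
    rw [h, mul_comm]
    congr 1
    · have : (inner ℝ (2 * s) (a k • (1 / 2 : ℝ)) : ℝ) = a k * s := by
        simp; ring
      rw [this]
    · refine Finset.prod_congr rfl fun j _ => ?_
      rw [Real.norm_eq_abs, ← abs_mul, show a j * (2 * s) = 2 * (a j * s) by ring, abs_mul, abs_two,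
        mul_div_cancel_left₀ _ (two_ne_zero)]
      rcases abs_cases (a j * s) with ⟨h, _⟩ | ⟨h, _⟩ <;> rw [h]
      rw [Real.sinc_neg]
  · have := tendsto_integral_sinc_mul_cos ham
      ‖a k • (1 / 2 : ℝ) + ∑ j : Others k m, a j • z j‖
    rwa [abs_norm] at this

/-- As in the real case, with kernel weight `jOne (a m * s) * s`. The frequency is s/α because the
disc has characteristic function jOne(α‖w‖). -/
theorem hasImproperIntegral_jOne (hkm : k ≠ m) (ham : a m ≠ 0) :
    HasImproperIntegral
      (fun s => (∏ j ∈ Finset.univ.erase k, jOne (a j * s)) * besselJ 0 (a k * s) * s)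
      (2 / a m ^ 2 * slabMeasure discRadius a k m (discRadius : ℂ)) := by
  have hα := discRadius_pos
  have hfinB := isFiniteMeasure_restrict_closedBall (E := ℂ) discRadius
  have hfin := isFiniteMeasure_ballProd ℂ (Others k m) discRadius
  have hJ := continuous_besselJ 0
  have hj := continuous_jOne
  refine hasImproperIntegral_of_kernel (q := fun s => jOne (a m * s) * s)
    (Φ := fun s y => besselJ 0 (s / discRadius * y)) (C := 4 / a m ^ 2)
    (ρ := |a m| * discRadius)
    (N := fun z : Others k m → ℂ => ‖a k • (discRadius : ℂ) + ∑ j : Others k m, a j • z j‖)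
    ?_ (by fun_prop) ?_ (fun _ _ => abs_besselJ_zero_le_one _) (by fun_prop) ?_
    (fun z R => ?_) (fun z => ?_)
  · fun_prop
  · simp only [Function.uncurry_def]; fun_prop
  · intro s
    rw [prod_erase_eq_mul_prod_others hkm, mul_right_comm, mul_right_comm _ _ s, mul_assoc]
    congr 1
    rw [integral_besselJ_zero_norm_add (c := ∏ j : Others k m, jOne (a j * s)) (by fun_prop)]
    · rw [mul_comm]
      congr 1
      rw [norm_smul, Complex.norm_real, Real.norm_eq_abs, Real.norm_eq_abs, abs_of_pos hα,
        ← besselJ_zero_abs (s / discRadius * _), ← besselJ_zero_abs (a k * s)]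
      congr 1
      rw [abs_mul, abs_mul (s / discRadius), abs_mul |a k|, abs_abs, abs_div, abs_of_pos hα]
      field_simp
    · intro w hw
      refine integral_cos_inner_add (by fun_prop) ?_ _
      rw [integral_pi_exp_inner_sum _ (g := fun t => jOne (discRadius * t))
        integral_closedBall_exp_inner_complex (fun j : Others k m => a j) w, hw]
      congr 1
      refine Finset.prod_congr rfl fun j _ => ?_
      rw [abs_div, abs_of_pos hα, ← jOne_abs (a j * s), abs_mul]
      congr 1
      field_simp
  · have := abs_integral_jOne_mul_besselJ_zero_le ham
      (norm_nonneg (a k • (discRadius : ℂ) + ∑ j : Others k m, a j • z j)) R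
    simpa only [mul_right_comm _ (besselJ _ _)] using this
  · have := tendsto_integral_jOne_mul_besselJ_zero ham
      (norm_nonneg (a k • (discRadius : ℂ) + ∑ j : Others k m, a j • z j))
    simpa only [mul_right_comm _ (besselJ _ _)] using this

end SectionIntegrals

/-! ### Volumes of face sections and of their overlaps. -/

section Faces

variable {ι E : Type*} [Fintype ι] [NormedAddCommGroup E] [InnerProductSpace ℝ E]

/-- The points of the cube of radius `α` in the hyperplane `∑ i, a i • x i = 0` whose `k`-th
coordinate is `u`. -/
def faceSection (α : ℝ) (a : ι → ℝ) (k : ι) (u : E) : Set (PiLp 2 (fun _ : ι => E)) :=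
  {x | (∀ j, ‖x j‖ ≤ α) ∧ x k = u ∧ ∑ i, a i • x i = 0}

/-- The points of `faceSection` that have no boundary coordinate before the `k`-th. -/
def firstFaceSection [LT ι] (α : ℝ) (a : ι → ℝ) (k : ι) (u : E) :
    Set (PiLp 2 (fun _ : ι => E)) :=
  {x ∈ faceSection α a k u | ∀ j < k, ‖x j‖ ≠ α}

variable {α : ℝ} {a : ι → ℝ} {k l m : ι} {u : E}

/-- The coefficients are real, so one isometry applied to all coordinates preserves the relation as
well as the norms. Volumes therefore do not depend on the choice of the boundary point. -/
theorem image_faceSection (U : E ≃ₗᵢ[ℝ] E) :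
    LinearIsometryEquiv.piLpCongrRight 2 (fun _ : ι => U) '' faceSection α a k u =
      faceSection α a k (U u) := by
  ext x
  rw [(LinearIsometryEquiv.piLpCongrRight 2 (fun _ : ι => U)).image_eq_preimage_symm]
  simp only [faceSection, Set.mem_preimage, Set.mem_ofPred_eq,
    LinearIsometryEquiv.piLpCongrRight_symm, LinearIsometryEquiv.piLpCongrRight_apply,
    LinearIsometryEquiv.norm_map, ← map_smul, ← map_sum, EmbeddingLike.map_eq_zero_iff,
    LinearIsometryEquiv.symm_apply_eq]

theorem image_firstFaceSection [LT ι] (U : E ≃ₗᵢ[ℝ] E) :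
    LinearIsometryEquiv.piLpCongrRight 2 (fun _ : ι => U) '' firstFaceSection α a k u =
      firstFaceSection α a k (U u) := by
  have h := image_faceSection (α := α) (a := a) (k := k) (u := u) U
  rw [(LinearIsometryEquiv.piLpCongrRight 2 (fun _ : ι => U)).image_eq_preimage_symm] at h ⊢
  ext x
  have hx := congrArg (x ∈ ·) h
  simp only [Set.mem_preimage, eq_iff_iff] at hx
  simp only [firstFaceSection, Set.mem_preimage, Set.mem_ofPred_eq, hx]
  simp only [LinearIsometryEquiv.piLpCongrRight_symm, LinearIsometryEquiv.piLpCongrRight_apply,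
    LinearIsometryEquiv.norm_map]

theorem isClosed_faceSection : IsClosed (faceSection (ι := ι) α a k u) := by
  have h : faceSection (ι := ι) α a k u =
      (⋂ j, {x | ‖x j‖ ≤ α}) ∩ ({x | x k = u} ∩ {x | ∑ i, a i • x i = 0}) := by
    ext x; simp [faceSection]
  rw [h]
  refine IsClosed.inter ?_ (IsClosed.inter ?_ ?_)
  · exact isClosed_iInter fun j => isClosed_le (f := fun x : PiLp 2 (fun _ : ι => E) => ‖x j‖)
      (by fun_prop) continuous_const
  · exact isClosed_eq (f := fun x : PiLp 2 (fun _ : ι => E) => x k) (by fun_prop) continuous_const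
  · exact isClosed_eq (f := fun x : PiLp 2 (fun _ : ι => E) => ∑ i, a i • x i)
      (by fun_prop) continuous_const

/-- If |a_k| = 1, all other coefficients vanish and the relation forces x_k = 0, which is not on the
boundary. -/
theorem faceSection_eq_empty (ha : ∑ i, a i ^ 2 = 1) (hα : 0 < α) (hu : ‖u‖ = α)
    (hk : |a k| = 1) : faceSection α a k u = ∅ := by
  classical
  rw [Set.eq_empty_iff_forall_notMem]
  rintro x ⟨_, hxk, hx⟩
  have h0 : ∀ j, j ≠ k → a j = 0 := by
    intro j hj
    rw [← Finset.add_sum_erase _ _ (Finset.mem_univ k), ← sq_abs, hk, one_pow,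
      add_eq_left, Finset.sum_eq_zero_iff_of_nonneg (fun _ _ => sq_nonneg _)] at ha
    exact pow_eq_zero_iff two_ne_zero |>.1 (ha j (by simp [hj]))
  rw [Finset.sum_eq_single k (fun j _ hj => by rw [h0 j hj, zero_smul]) (by simp), hxk] at hx
  have := congrArg norm hx
  rw [norm_smul, hu, Real.norm_eq_abs, hk, norm_zero, one_mul] at this
  exact hα.ne' this

variable [FiniteDimensional ℝ E] [MeasurableSpace E] [BorelSpace E]

theorem measurableSet_firstFaceSection [LT ι] :
    MeasurableSet (firstFaceSection (ι := ι) α a k u) := by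
  have h : firstFaceSection (ι := ι) α a k u =
      faceSection α a k u ∩ ⋂ j, ⋂ (_ : j < k), {x | ‖x j‖ = α}ᶜ := by
    ext x; simp [firstFaceSection]
  rw [h]
  refine isClosed_faceSection.measurableSet.inter ?_
  refine MeasurableSet.iInter fun j => MeasurableSet.iInter fun _ => MeasurableSet.compl ?_
  exact (isClosed_eq (f := fun x : PiLp 2 (fun _ : ι => E) => ‖x j‖) (by fun_prop)
    continuous_const).measurableSet

variable [DecidableEq ι]

/-- The volume of the section of a face, in terms of a product of balls. -/
theorem measure_faceSection (hkm : k ≠ m) (ham : a m ≠ 0)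
    (ha : ∑ i, a i ^ 2 = 1) (hu : ‖u‖ = α) :
    μHE[Module.finrank ℝ E * (Fintype.card ι - 2)] (faceSection α a k u) =
      ENNReal.ofReal ((Real.sqrt (1 - a k ^ 2) / |a m|) ^ Module.finrank ℝ E) *
        ballProd E (Others k m) α {z | ‖a k • u + ∑ j : Others k m, a j • z j‖ ≤ |a m| * α} := by
  refine (euclideanHausdorffMeasure_face_section hkm ham ha u {x | ∀ j, ‖x j‖ ≤ α}).trans ?_
  congr 1
  -- The bounds on the free coordinates go into the restricted measure, the k-th bound holds as ‖u‖
  -- = α, and the m-th is the slab condition.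
  rw [ballProd, ← Measure.restrict_pi_pi, ← volume_pi, Measure.restrict_apply]
  · congr 1
    ext z
    simp only [Set.mem_ofPred_eq, Set.mem_inter_iff, Set.mem_pi, Set.mem_univ, forall_true_left,
      mem_closedBall_zero_iff]
    have hm : ‖hyperplanePoint a k m u z m‖ ≤ α ↔
        ‖a k • u + ∑ j : Others k m, a j • z j‖ ≤ |a m| * α := by
      rw [hyperplanePoint_snd hkm, norm_smul, norm_neg, norm_inv, Real.norm_eq_abs,
        inv_mul_le_iff₀ (abs_pos.2 ham)]
    constructor
    · intro h
      exact ⟨hm.1 (h m), fun j => hyperplanePoint_others u z j ▸ h j⟩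
    · rintro ⟨h1, h2⟩ j
      by_cases hj : j = k
      · subst hj; rw [hyperplanePoint_fst]; exact hu.le
      by_cases hj' : j = m
      · subst hj'; exact hm.2 h1
      · exact (hyperplanePoint_others u z ⟨j, hj, hj'⟩).symm ▸ h2 ⟨j, hj, hj'⟩
  · exact measurableSet_le (by fun_prop) measurable_const

/-- The volume of the part of the section of a face on which the `m`-th coordinate is a boundary
coordinate, too. -/
theorem measure_faceSection_inter (hkm : k ≠ m) (ham : a m ≠ 0)
    (ha : ∑ i, a i ^ 2 = 1) (hu : ‖u‖ = α) :
    μHE[Module.finrank ℝ E * (Fintype.card ι - 2)] (faceSection α a k u ∩ {x | ‖x m‖ = α}) =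
      ENNReal.ofReal ((Real.sqrt (1 - a k ^ 2) / |a m|) ^ Module.finrank ℝ E) *
        ballProd E (Others k m) α {z | ‖a k • u + ∑ j : Others k m, a j • z j‖ = |a m| * α} := by
  have h := euclideanHausdorffMeasure_face_section hkm ham ha u
    {x | (∀ j, ‖x j‖ ≤ α) ∧ ‖x m‖ = α}
  have hset : (faceSection α a k u ∩ {x | ‖x m‖ = α} : Set (PiLp 2 (fun _ : ι => E))) =
      {x | x ∈ {x : PiLp 2 (fun _ : ι => E) | (∀ j, ‖x j‖ ≤ α) ∧ ‖x m‖ = α} ∧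
        x k = u ∧ ∑ i, a i • x i = 0} := by
    ext x
    simp only [faceSection, Set.mem_inter_iff, Set.mem_ofPred_eq]
    tauto
  rw [hset, h]
  congr 1
  rw [ballProd, ← Measure.restrict_pi_pi, ← volume_pi, Measure.restrict_apply]
  · congr 1
    ext z
    simp only [Set.mem_ofPred_eq, Set.mem_inter_iff, Set.mem_pi, Set.mem_univ, forall_true_left,
      mem_closedBall_zero_iff]
    have hm : ‖hyperplanePoint a k m u z m‖ = α ↔
        ‖a k • u + ∑ j : Others k m, a j • z j‖ = |a m| * α := by
      rw [hyperplanePoint_snd hkm, norm_smul, norm_neg, norm_inv, Real.norm_eq_abs,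
        inv_mul_eq_iff_eq_mul₀ (abs_ne_zero.2 ham)]
    constructor
    · rintro ⟨h, h'⟩
      exact ⟨hm.1 h', fun j => hyperplanePoint_others u z j ▸ h j⟩
    · rintro ⟨h1, h2⟩
      refine ⟨fun j => ?_, hm.2 h1⟩
      by_cases hj : j = k
      · subst hj; rw [hyperplanePoint_fst]; exact hu.le
      by_cases hj' : j = m
      · subst hj'; exact (hm.2 h1).le
      · exact (hyperplanePoint_others u z ⟨j, hj, hj'⟩).symm ▸ h2 ⟨j, hj, hj'⟩
  · exact measurableSet_eq_fun (by fun_prop) measurable_const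

/-- With x_m eliminated, x_l is a free coordinate, and confining it to a sphere gives a null set. -/
theorem measure_faceSection_inter_of_ne (hkm : k ≠ m) (ham : a m ≠ 0)
    (ha : ∑ i, a i ^ 2 = 1) (hα : 0 < α) (u : E) (hlk : l ≠ k) (hlm : l ≠ m) :
    μHE[Module.finrank ℝ E * (Fintype.card ι - 2)] (faceSection α a k u ∩ {x | ‖x l‖ = α}) = 0 := by
  have h := euclideanHausdorffMeasure_face_section hkm ham ha u {x | ‖x l‖ = α}
  refine measure_mono_null (t := {x : PiLp 2 (fun _ : ι => E) | x ∈ {x : PiLp 2 (fun _ : ι => E) |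
    ‖x l‖ = α} ∧ x k = u ∧ ∑ i, a i • x i = 0}) ?_ ?_
  · rintro x ⟨hx, hx'⟩
    exact ⟨hx', hx.2⟩
  · rw [h]
    refine mul_eq_zero_of_right _ ?_
    let l' : Others k m := ⟨l, hlk, hlm⟩
    have hs : {z : Others k m → E | hyperplanePoint a k m u z ∈
        {x : PiLp 2 (fun _ : ι => E) | ‖x l‖ = α}} =
        Function.eval l' ⁻¹' Metric.sphere 0 α := by
      ext z
      simp only [Set.mem_ofPred_eq, Set.mem_preimage, Function.eval, mem_sphere_zero_iff_norm]
      rw [hyperplanePoint_others u z l']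
    rw [hs, volume_pi]
    exact Measure.pi_eval_preimage_null _ (Measure.addHaar_sphere_of_ne_zero _ _ hα.ne')

theorem exists_ne_zero_of_abs_ne_one (ha : ∑ i, a i ^ 2 = 1) (hk : |a k| ≠ 1) :
    ∃ m, k ≠ m ∧ a m ≠ 0 := by
  by_contra! h
  rw [Finset.sum_eq_single k (fun j _ hj => by rw [h j hj.symm]; simp) (by simp)] at ha
  exact hk ((pow_eq_one_iff_of_nonneg (abs_nonneg _) two_ne_zero).1 (by rwa [sq_abs]))

/-- If a third coefficient is nonzero, eliminate its coordinate. Otherwise the relation is a_k x_k +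
a_l x_l = 0, and equal norms force |a_k| = |a_l|, so the overlap is empty. -/
theorem measure_faceSection_inter_eq_zero (ha : ∑ i, a i ^ 2 = 1) (hα : 0 < α) (hu : ‖u‖ = α)
    (hlk : l ≠ k)
    (hdeg : ¬(|a k| = |a l| ∧ ∀ j, j ≠ k → j ≠ l → a j = 0)) :
    μHE[Module.finrank ℝ E * (Fintype.card ι - 2)] (faceSection α a k u ∩ {x | ‖x l‖ = α}) = 0 := by
  by_cases h : ∃ m, k ≠ m ∧ l ≠ m ∧ a m ≠ 0
  · obtain ⟨m, hkm, hlm, ham⟩ := h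
    exact measure_faceSection_inter_of_ne hkm ham ha hα u hlk hlm
  · push Not at h
    have hne : |a k| ≠ |a l| := fun h' => hdeg ⟨h', fun j hjk hjl => h j hjk.symm hjl.symm⟩
    have hempty : (faceSection α a k u ∩ {x | ‖x l‖ = α} : Set (PiLp 2 (fun _ : ι => E))) = ∅ := by
      rw [Set.eq_empty_iff_forall_notMem]
      rintro x ⟨⟨_, hxk, hx⟩, hxl⟩
      have hxl : ‖x l‖ = α := hxl
      rw [sum_eq_add_add_sum_others hlk.symm, Finset.sum_eq_zero
        (fun j _ => by rw [h j j.2.1.symm j.2.2.symm, zero_smul]), add_zero, hxk,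
        add_eq_zero_iff_eq_neg] at hx
      have := congrArg norm hx
      rw [norm_neg, norm_smul, norm_smul, hu, hxl, Real.norm_eq_abs, Real.norm_eq_abs] at this
      exact hne (mul_right_cancel₀ hα.ne' this)
    rw [hempty, measure_empty]

theorem measure_faceSection_ne_top (ha : ∑ i, a i ^ 2 = 1) (hα : 0 < α) (hu : ‖u‖ = α) :
    μHE[Module.finrank ℝ E * (Fintype.card ι - 2)] (faceSection α a k u) ≠ ⊤ := by
  by_cases hk : |a k| = 1
  · rw [faceSection_eq_empty ha hα hu hk, measure_empty]
    exact ENNReal.zero_ne_top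
  · obtain ⟨m, hkm, ham⟩ := exists_ne_zero_of_abs_ne_one ha hk
    have := isFiniteMeasure_ballProd E (Others k m) α
    rw [measure_faceSection hkm ham ha hu]
    exact ENNReal.mul_ne_top ENNReal.ofReal_ne_top (measure_ne_top _ _)

end Faces

/-! ### The exceptional directions with overlapping faces. -/

section DegeneratePair

variable {ι E : Type*} {a : ι → ℝ} {k l m : ι}

/-- Two coefficients have the same absolute value, and the others vanish. -/
def IsDegeneratePair (a : ι → ℝ) (k l : ι) : Prop :=
  |a k| = |a l| ∧ ∀ j, j ≠ k → j ≠ l → a j = 0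

theorem IsDegeneratePair.symm (h : IsDegeneratePair a k l) : IsDegeneratePair a l k :=
  ⟨h.1.symm, fun j h1 h2 => h.2 j h2 h1⟩

variable [Fintype ι]

theorem IsDegeneratePair.ne_zero (h : IsDegeneratePair a k l) (ha : ∑ i, a i ^ 2 = 1) :
    a k ≠ 0 := by
  intro h0
  have hl : a l = 0 := by
    have := h.1
    rwa [h0, abs_zero, eq_comm, abs_eq_zero] at this
  have : ∀ j, a j = 0 := by
    intro j
    by_cases h1 : j = k
    · rw [h1, h0]
    by_cases h2 : j = l
    · rw [h2, hl]
    exact h.2 j h1 h2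
  simp [this] at ha

variable [DecidableEq ι] [NormedAddCommGroup E] [InnerProductSpace ℝ E]

theorem IsDegeneratePair.eq_or_eq_neg (h : IsDegeneratePair a k m) (hkm : k ≠ m) (ham : a m ≠ 0)
    {x : PiLp 2 (fun _ : ι => E)} (hx : ∑ i, a i • x i = 0) :
    (a k = -a m ∧ x k = x m) ∨ (a k = a m ∧ x k = -x m) := by
  rw [sum_eq_add_add_sum_others hkm, Finset.sum_eq_zero
    (fun j _ => by rw [h.2 j j.2.1 j.2.2, zero_smul]), add_zero] at hx
  rcases abs_eq_abs.1 h.1 with h1 | h1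
  · rw [h1, ← smul_add, smul_eq_zero_iff_right ham] at hx
    exact Or.inr ⟨h1, eq_neg_of_add_eq_zero_left hx⟩
  · rw [h1, neg_smul, ← sub_eq_neg_add, ← smul_sub, smul_eq_zero_iff_right ham, sub_eq_zero] at hx
    exact Or.inl ⟨h1, hx.symm⟩

theorem IsDegeneratePair.norm_eq (h : IsDegeneratePair a k m) (hkm : k ≠ m) (ham : a m ≠ 0)
    {x : PiLp 2 (fun _ : ι => E)} (hx : ∑ i, a i • x i = 0) : ‖x k‖ = ‖x m‖ := by
  rcases h.eq_or_eq_neg hkm ham hx with ⟨_, h⟩ | ⟨_, h⟩ <;> simp [h]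

end DegeneratePair

/-! ### Adding up the faces. -/

section Perimeter

variable {ι E : Type*} [Fintype ι] [LinearOrder ι] [NormedAddCommGroup E] [InnerProductSpace ℝ E]
  [FiniteDimensional ℝ E] [MeasurableSpace E] [BorelSpace E] {α : ℝ} {a : ι → ℝ} {k m : ι} {u : E}

/-- Equality in the slab condition means that x_m is a boundary coordinate too, so the half weight
at the jump subtracts half of that overlap. -/
theorem weight_mul_slabMeasure (hkm : k ≠ m) (ham : a m ≠ 0) (ha : ∑ i, a i ^ 2 = 1)
    (hu : ‖u‖ = α) :
    (Real.sqrt (1 - a k ^ 2) / |a m|) ^ Module.finrank ℝ E * slabMeasure α a k m u =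
      μHE[Module.finrank ℝ E * (Fintype.card ι - 2)].real (faceSection α a k u) -
      1 / 2 * μHE[Module.finrank ℝ E * (Fintype.card ι - 2)].real
        (faceSection α a k u ∩ {x | ‖x m‖ = α}) := by
  simp only [Measure.real, measure_faceSection hkm ham ha hu,
    measure_faceSection_inter hkm ham ha hu, slabMeasure, ENNReal.toReal_mul]
  rw [ENNReal.toReal_ofReal (by positivity)]
  ring

theorem measure_firstFaceSection (ha : ∑ i, a i ^ 2 = 1) (hα : 0 < α) (hu : ‖u‖ = α)
    (h : ∀ l < k, ¬ IsDegeneratePair a k l) :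
    μHE[Module.finrank ℝ E * (Fintype.card ι - 2)] (firstFaceSection α a k u) =
      μHE[Module.finrank ℝ E * (Fintype.card ι - 2)] (faceSection α a k u) := by
  have hs : (firstFaceSection α a k u : Set (PiLp 2 (fun _ : ι => E))) =
      faceSection α a k u \ ⋃ l, ⋃ (_ : l < k), (faceSection α a k u ∩ {x | ‖x l‖ = α}) := by
    ext x
    simp only [firstFaceSection, Set.mem_ofPred_eq, Set.mem_sdiff, Set.mem_iUnion,
      Set.mem_inter_iff, exists_prop, not_exists, not_and]
    constructor
    · rintro ⟨h1, h2⟩; exact ⟨h1, fun l hl _ => h2 l hl⟩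
    · rintro ⟨h1, h2⟩; exact ⟨h1, fun l hl => h2 l hl h1⟩
  rw [hs]
  refine measure_sdiff_null ?_
  rw [measure_iUnion_null_iff]
  intro l
  rw [measure_iUnion_null_iff]
  intro hl
  exact measure_faceSection_inter_eq_zero ha hα hu hl.ne (h l hl)

theorem measure_faceSection_isometry (d : ℕ) (U : E ≃ₗᵢ[ℝ] E) :
    μHE[d] (faceSection α a k (U u)) = μHE[d] (faceSection α a k u) := by
  rw [← image_faceSection, (LinearIsometryEquiv.isometry _).euclideanHausdorffMeasure_image]

theorem measure_firstFaceSection_isometry (d : ℕ) (U : E ≃ₗᵢ[ℝ] E) :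
    μHE[d] (firstFaceSection α a k (U u)) = μHE[d] (firstFaceSection α a k u) := by
  rw [← image_firstFaceSection, (LinearIsometryEquiv.isometry _).euclideanHausdorffMeasure_image]

theorem IsDegeneratePair.measure_faceSection_eq (h : IsDegeneratePair a k m) (hkm : k ≠ m)
    (ham : a m ≠ 0) (d : ℕ) :
    μHE[d] (faceSection α a k u) = μHE[d] (faceSection α a m u) := by
  rcases abs_eq_abs.1 h.1 with h1 | h1
  · have : faceSection α a k u = faceSection α a m (-u) := by
      ext x
      simp only [faceSection, Set.mem_ofPred_eq]
      refine and_congr_right fun _ => and_congr_left fun hx => ?_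
      rcases h.eq_or_eq_neg hkm ham hx with ⟨h2, h3⟩ | ⟨_, h3⟩
      · exact absurd (by linarith : a m = 0) ham
      · rw [h3, neg_eq_iff_eq_neg]
    rw [this]
    exact measure_faceSection_isometry d (LinearIsometryEquiv.neg ℝ)
  · have : faceSection α a k u = faceSection α a m u := by
      ext x
      simp only [faceSection, Set.mem_ofPred_eq]
      refine and_congr_right fun _ => and_congr_left fun hx => ?_
      rcases h.eq_or_eq_neg hkm ham hx with ⟨_, h3⟩ | ⟨h2, h3⟩
      · rw [h3]
      · exact absurd (by linarith : a m = 0) ham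
    rw [this]

/-- The total volume of the parts of the boundary section with a prescribed boundary coordinate. -/
theorem sum_measure_firstFaceSection (ha : ∑ i, a i ^ 2 = 1) (hα : 0 < α) (hu : ‖u‖ = α)
    (m : ι → ι) (hm : ∀ k, |a k| ≠ 1 → k ≠ m k ∧ a (m k) ≠ 0) :
    ∑ k, μHE[Module.finrank ℝ E * (Fintype.card ι - 2)].real (firstFaceSection α a k u) =
      ∑ k, if |a k| = 1 then 0 else
        (Real.sqrt (1 - a k ^ 2) / |a (m k)|) ^ Module.finrank ℝ E *
          slabMeasure α a k (m k) u := by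
  set μ : Measure (PiLp 2 (fun _ : ι => E)) := μHE[Module.finrank ℝ E * (Fintype.card ι - 2)] with hμ
  -- For an index in no degenerate pair all overlaps are null, so both sides are the full volume of
  -- the section, or 0 if |a_k| = 1.
  have hgood : ∀ k, (∀ l, l ≠ k → ¬ IsDegeneratePair a k l) →
      μ.real (firstFaceSection α a k u) = if |a k| = 1 then 0 else
        (Real.sqrt (1 - a k ^ 2) / |a (m k)|) ^ Module.finrank ℝ E *
          slabMeasure α a k (m k) u := by
    intro k hk
    split_ifs with h1
    · rw [measureReal_def, measure_mono_null (t := faceSection α a k u) (fun x hx => hx.1)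
        (by rw [faceSection_eq_empty ha hα hu h1, measure_empty]), ENNReal.toReal_zero]
    · obtain ⟨hkm, ham⟩ := hm k h1
      rw [weight_mul_slabMeasure hkm ham ha hu, measureReal_def, measureReal_def, measureReal_def,
        measure_firstFaceSection ha hα hu (fun l hl => hk l hl.ne),
        measure_faceSection_inter_eq_zero ha hα hu hkm.symm (hk _ hkm.symm)]
      simp
  by_cases hdeg : ∃ p q, p < q ∧ IsDegeneratePair a p q
  · obtain ⟨p, q, hpq, h⟩ := hdeg
    have hp := h.ne_zero ha
    have hq := h.symm.ne_zero ha
    have habs : ∀ i, (i = p ∨ i = q) → |a i| ≠ 1 := by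
      intro i hi h1
      have h2 := sum_eq_add_add_sum_others hpq.ne (fun i => a i ^ 2)
      rw [ha, Finset.sum_eq_zero (fun j _ => by rw [h.2 j j.2.1 j.2.2]; simp), add_zero,
        ← sq_abs (a p), ← sq_abs (a q)] at h2
      rcases hi with rfl | rfl
      · rw [← h.1, h1] at h2; norm_num at h2
      · rw [h.1, h1] at h2; norm_num at h2
    have hmp : m p = q := by
      by_contra hne
      exact (hm p (habs p (Or.inl rfl))).2 (h.2 _ (hm p (habs p (Or.inl rfl))).1.symm hne)
    have hmq : m q = p := by
      by_contra hne
      exact (hm q (habs q (Or.inr rfl))).2 (h.2 _ hne (hm q (habs q (Or.inr rfl))).1.symm)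
    have hV : μ.real (faceSection α a p u) = μ.real (faceSection α a q u) := by
      rw [measureReal_def, measureReal_def, h.measure_faceSection_eq hpq.ne hq]
    -- The whole section lies in the overlap, so each of the two slab terms is half a section. On
    -- the other side, `p` gets the full section and `q` nothing.
    have hSp : faceSection α a p u ∩ {x | ‖x q‖ = α} = faceSection α a p u := by
      refine Set.inter_eq_left.2 fun x hx => ?_
      rw [Set.mem_ofPred_eq, ← h.norm_eq hpq.ne hq hx.2.2, hx.2.1, hu]
    have hSq : faceSection α a q u ∩ {x | ‖x p‖ = α} = faceSection α a q u := by
      refine Set.inter_eq_left.2 fun x hx => ?_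
      rw [Set.mem_ofPred_eq, h.norm_eq hpq.ne hq hx.2.2, hx.2.1, hu]
    have hDq : firstFaceSection α a q u = ∅ := by
      rw [Set.eq_empty_iff_forall_notMem]
      intro x hx
      have : x ∈ faceSection α a q u ∩ {x | ‖x p‖ = α} := hSq.symm ▸ hx.1
      exact hx.2 p hpq this.2
    have hDp : μ.real (firstFaceSection α a p u) = μ.real (faceSection α a p u) := by
      rw [measureReal_def, measureReal_def, measure_firstFaceSection ha hα hu]
      intro l hl h'
      exact hq (h'.2 q hpq.ne' (hl.trans hpq).ne')
    rw [sum_eq_add_add_sum_others hpq.ne, sum_eq_add_add_sum_others hpq.ne,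
      if_neg (habs p (Or.inl rfl)), if_neg (habs q (Or.inr rfl)), hmp, hmq,
      weight_mul_slabMeasure hpq.ne hq ha hu, weight_mul_slabMeasure hpq.ne' hp ha hu, ← hμ,
      hSp, hSq, hDq, hDp, hV, measureReal_empty]
    congr 1
    · ring
    -- No other index is in a degenerate pair: a pair other than {p, q} would force `a p` or `a q`
    -- to vanish.
    · refine Finset.sum_congr rfl fun j _ => hgood j fun l hl h' => ?_
      by_cases hlp : l = p
      · exact hq (h'.2 q j.2.2.symm (hlp ▸ hpq.ne'))
      · exact hp (h'.2 p j.2.1.symm (Ne.symm hlp))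
  · refine Finset.sum_congr rfl fun k _ => hgood k fun l hl h => hdeg ?_
    rcases lt_or_gt_of_ne hl with h1 | h1
    · exact ⟨l, k, h1, h.symm⟩
    · exact ⟨k, l, h1, h⟩

theorem measure_firstFaceSection_ne_top (ha : ∑ i, a i ^ 2 = 1) (hα : 0 < α) (hu : ‖u‖ = α) :
    μHE[Module.finrank ℝ E * (Fintype.card ι - 2)] (firstFaceSection α a k u) ≠ ⊤ :=
  ((measure_mono fun _ hx => hx.1).trans_lt
    (measure_faceSection_ne_top ha hα hu).lt_top).ne

end Perimeter

/-! ### The boundary of the cube and the perimeters. -/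

section Boundary

variable {𝕜 : Type*} [RCLike 𝕜] {n : ℕ}

theorem frontier_cubeOfRadius {α : ℝ} (hα : 0 < α) :
    frontier (cubeOfRadius 𝕜 n α) = {x | (∀ k, ‖x k‖ ≤ α) ∧ ∃ k, ‖x k‖ = α} := by
  let e := (PiLp.continuousLinearEquiv 2 𝕜 (fun _ : Fin n => 𝕜)).toHomeomorph
  have hc : cubeOfRadius 𝕜 n α = e ⁻¹' Set.pi Set.univ fun _ => Metric.closedBall (0 : 𝕜) α := by
    ext x
    simp only [cubeOfRadius, Set.mem_ofPred_eq, Set.mem_preimage, Set.mem_pi, Set.mem_univ,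
      forall_true_left, mem_closedBall_zero_iff]
    rfl
  have hcl : IsClosed (Set.pi Set.univ fun _ : Fin n => Metric.closedBall (0 : 𝕜) α) :=
    isClosed_set_pi fun _ _ => Metric.isClosed_closedBall
  rw [hc, ← e.preimage_frontier, hcl.frontier_eq, interior_pi_set Set.finite_univ]
  ext x
  simp only [interior_closedBall _ hα.ne', Set.mem_preimage, Set.mem_sdiff, Set.mem_pi,
    Set.mem_univ, forall_true_left, mem_closedBall_zero_iff, mem_ball_zero_iff, Set.mem_ofPred_eq,
    not_forall, not_lt]
  refine and_congr_right fun h => exists_congr fun k => ?_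
  exact ⟨fun h' => le_antisymm (h k) h', fun h' => h'.ge⟩

end Boundary

section Boundary

variable {n : ℕ}

theorem mem_boundarySection_real {α : ℝ} (hα : 0 < α) (a x : EuclideanSpace ℝ (Fin n)) :
    x ∈ boundarySection α a ↔
      ((∀ k, ‖x k‖ ≤ α) ∧ ∃ k, ‖x k‖ = α) ∧ ∑ i, a i • x i = 0 := by
  rw [boundarySection, frontier_cubeOfRadius hα, Set.mem_inter_iff, Set.mem_ofPred_eq,
    SetLike.mem_coe, Submodule.mem_orthogonal_singleton_iff_inner_right, PiLp.inner_apply]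
  simp [mul_comm]

theorem mem_boundarySection_complex {α : ℝ} (hα : 0 < α) (a : EuclideanSpace ℝ (Fin n))
    (x : EuclideanSpace ℂ (Fin n)) :
    x ∈ boundarySection α (toComplexVector a) ↔
      ((∀ k, ‖x k‖ ≤ α) ∧ ∃ k, ‖x k‖ = α) ∧ ∑ i, a i • x i = 0 := by
  rw [boundarySection, frontier_cubeOfRadius hα, Set.mem_inter_iff, Set.mem_ofPred_eq,
    SetLike.mem_coe, Submodule.mem_orthogonal_singleton_iff_inner_right, PiLp.inner_apply]
  simp [toComplexVector, mul_comm]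

theorem boundarySection_real {α : ℝ} (hα : 0 < α) (a : EuclideanSpace ℝ (Fin n)) :
    boundarySection α a =
      ⋃ k, (firstFaceSection α a k α ∪ firstFaceSection α a k (-α)) := by
  ext x
  rw [mem_boundarySection_real hα]
  simp only [firstFaceSection, faceSection, Set.mem_iUnion, Set.mem_union, Set.mem_ofPred_eq]
  constructor
  · rintro ⟨⟨h1, h2⟩, h3⟩
    classical
    obtain ⟨k, hk, hmin⟩ := (Finset.univ.filter fun k => ‖x k‖ = α).exists_minimal
      (by obtain ⟨k, hk⟩ := h2; exact ⟨k, by simpa using hk⟩)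
    have hk' : ‖x k‖ = α := by simpa using hk
    have hlt : ∀ j < k, ‖x j‖ ≠ α := fun j hj h =>
      absurd (hmin (y := j) (by simpa using h) hj.le) (not_le.2 hj)
    refine ⟨k, ?_⟩
    rcases (abs_eq hα.le).1 hk' with h | h
    · exact Or.inl ⟨⟨h1, h, h3⟩, hlt⟩
    · exact Or.inr ⟨⟨h1, h, h3⟩, hlt⟩
  · rintro ⟨k, ⟨⟨h1, h2, h3⟩, _⟩ | ⟨⟨h1, h2, h3⟩, _⟩⟩ <;> refine ⟨⟨h1, k, ?_⟩, h3⟩ <;> rw [h2]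
    · exact abs_of_pos hα
    · rw [norm_neg]; exact abs_of_pos hα

theorem angularFace_eq (a : EuclideanSpace ℝ (Fin n)) (k : Fin n) (θ : ℝ) :
    angularFace (boundarySection discRadius (toComplexVector a)) k θ =
      firstFaceSection discRadius a k (discRadius * Complex.exp (θ * Complex.I)) := by
  have hα := discRadius_pos
  ext x
  simp only [angularFace, firstFaceSection, faceSection, Set.mem_ofPred_eq,
    mem_boundarySection_complex hα]
  constructor
  · rintro ⟨⟨⟨h1, _⟩, h3⟩, h4, h5⟩
    exact ⟨⟨h1, h4, h3⟩, h5⟩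
  · rintro ⟨⟨h1, h4, h3⟩, h5⟩
    refine ⟨⟨⟨h1, k, ?_⟩, h3⟩, h4, h5⟩
    rw [h4, norm_mul, Complex.norm_exp_ofReal_mul_I, mul_one, Complex.norm_real, Real.norm_eq_abs,
      abs_of_pos hα]

theorem firstFaceSection_disjoint {E : Type*} [NormedAddCommGroup E] [InnerProductSpace ℝ E]
    {α : ℝ} {a : Fin n → ℝ} {k l : Fin n} (hkl : k < l) {u v : E} (hu : ‖u‖ = α) :
    Disjoint (firstFaceSection α a k u) (firstFaceSection α a l v) := by
  rw [Set.disjoint_left]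
  intro x hx hx'
  exact hx'.2 k hkl (by rw [hx.1.2.1, hu])

/-- Attributing each boundary point to its first boundary coordinate makes the pieces disjoint; x ↦
-x exchanges the pieces at 1/2 and -1/2. -/
theorem realPerimeter_eq (a : EuclideanSpace ℝ (Fin n)) :
    realPerimeter a = ∑ k, 2 * μHE[n - 2] (firstFaceSection (1 / 2) a k (1 / 2 : ℝ)) := by
  have hα : (0 : ℝ) < 1 / 2 := by norm_num
  have hu : ‖(1 / 2 : ℝ)‖ = 1 / 2 := by norm_num
  have hu' : ‖(-(1 / 2) : ℝ)‖ = 1 / 2 := by norm_num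
  rw [realPerimeter, boundarySection_real hα, measure_iUnion, tsum_fintype]
  · refine Finset.sum_congr rfl fun k _ => ?_
    rw [measure_union _ measurableSet_firstFaceSection, two_mul]
    · congr 1
      exact measure_firstFaceSection_isometry (n - 2) (LinearIsometryEquiv.neg ℝ)
    · rw [Set.disjoint_left]
      intro x hx hx'
      have := hx.1.2.1.symm.trans hx'.1.2.1
      norm_num at this
  · intro k l hkl
    rcases lt_or_gt_of_ne hkl with h | h
    · simp only [Function.onFun, Set.disjoint_union_left, Set.disjoint_union_right]
      exact ⟨⟨firstFaceSection_disjoint h hu, firstFaceSection_disjoint h hu'⟩,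
        firstFaceSection_disjoint h hu, firstFaceSection_disjoint h hu'⟩
    · simp only [Function.onFun, Set.disjoint_union_left, Set.disjoint_union_right]
      exact ⟨⟨(firstFaceSection_disjoint h hu).symm, (firstFaceSection_disjoint h hu).symm⟩,
        (firstFaceSection_disjoint h hu').symm, (firstFaceSection_disjoint h hu').symm⟩
  · exact fun k => measurableSet_firstFaceSection.union measurableSet_firstFaceSection

/-- Rotating all coordinates by θ shows that the integrand is constant in θ. -/
theorem complexPerimeter_eq (a : EuclideanSpace ℝ (Fin n)) :
    complexPerimeter (toComplexVector a) = ENNReal.ofReal (2 * Real.pi) *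
      ∑ k, μHE[2 * (n - 2)] (firstFaceSection discRadius a k (discRadius : ℂ)) := by
  have h : ∀ (k : Fin n) (θ : ℝ),
      μHE[2 * (n - 2)] (angularFace (boundarySection discRadius (toComplexVector a)) k θ) =
        μHE[2 * (n - 2)] (firstFaceSection discRadius a k (discRadius : ℂ)) := by
    intro k θ
    have e : (discRadius * Complex.exp (θ * Complex.I) : ℂ) =
        rotation (Circle.exp θ) (discRadius : ℂ) := by
      rw [rotation_apply, Circle.coe_exp, mul_comm]
    rw [angularFace_eq, e]
    exact measure_firstFaceSection_isometry _ _
  rw [complexPerimeter]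
  simp_rw [h]
  rw [setLIntegral_const, Real.volume_Ioc, sub_zero, mul_comm]

theorem real_perimeter_formula (a : EuclideanSpace ℝ (Fin n)) (ha : ∑ i, a i ^ 2 = 1) :
    ∃ I : Fin n → ℝ,
      (∀ k, |a k| ≠ 1 →
        HasImproperIntegral
          (fun s => (∏ j ∈ Finset.univ.erase k, Real.sinc (a j * s)) * Real.cos (a k * s)) (I k)) ∧
      realPerimeter a ≠ ⊤ ∧
      (realPerimeter a).toReal =
        2 * ∑ k, Real.sqrt (1 - a k ^ 2) * (2 / Real.pi * I k) := by
  have hα : (0 : ℝ) < 1 / 2 := by norm_num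
  have hu : ‖(1 / 2 : ℝ)‖ = 1 / 2 := by norm_num
  have hm' : ∀ k, ∃ m, |a k| ≠ 1 → k ≠ m ∧ a m ≠ 0 := fun k => by
    by_cases hk : |a k| = 1
    · exact ⟨k, fun h => absurd hk h⟩
    · obtain ⟨m, hm⟩ := exists_ne_zero_of_abs_ne_one ha hk
      exact ⟨m, fun _ => hm⟩
  choose m hm using hm'
  have htop : ∀ k, μHE[n - 2] (firstFaceSection (1 / 2) a k (1 / 2 : ℝ)) ≠ ⊤ := fun k => by
    simpa using measure_firstFaceSection_ne_top (k := k) ha hα hu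
  have hsum := sum_measure_firstFaceSection ha hα hu m hm
  simp only [Module.finrank_self, one_mul, Fintype.card_fin, pow_one] at hsum
  -- The factor 2/π reduces π/(2|a_m|) to 1/|a_m|, the denominator of the Jacobian. For |a_k| = 1
  -- the value of `I k` is irrelevant, since its weight vanishes.
  refine ⟨fun k => Real.pi / (2 * |a (m k)|) * slabMeasure (1 / 2) a k (m k) (1 / 2 : ℝ),
    fun k hk => hasImproperIntegral_sinc (hm k hk).1 (hm k hk).2, ?_, ?_⟩
  · rw [realPerimeter_eq]
    exact ENNReal.sum_ne_top.2 fun k _ => ENNReal.mul_ne_top (by simp) (htop k)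
  · rw [realPerimeter_eq, ENNReal.toReal_sum fun k _ => ENNReal.mul_ne_top (by simp) (htop k)]
    simp_rw [ENNReal.toReal_mul]
    rw [← Finset.mul_sum]
    simp only [ENNReal.toReal_ofNat]
    congr 1
    refine hsum.trans (Finset.sum_congr rfl fun k _ => ?_)
    split_ifs with hk
    · rw [← sq_abs (a k), hk]; simp
    · have h1 := abs_pos.2 (hm k hk).2
      have := Real.pi_ne_zero
      field_simp

theorem complex_perimeter_formula (a : EuclideanSpace ℝ (Fin n)) (ha : ∑ i, a i ^ 2 = 1) :
    ∃ I : Fin n → ℝ,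
      (∀ k, |a k| ≠ 1 →
        HasImproperIntegral
          (fun s => (∏ j ∈ Finset.univ.erase k, jOne (a j * s)) * besselJ 0 (a k * s) * s) (I k)) ∧
      complexPerimeter (toComplexVector a) ≠ ⊤ ∧
      (complexPerimeter (toComplexVector a)).toReal =
        2 * Real.pi * ∑ k, (1 - a k ^ 2) * (1 / 2 * I k) := by
  have hα := discRadius_pos
  have hu : ‖(discRadius : ℂ)‖ = discRadius := by
    rw [Complex.norm_real, Real.norm_eq_abs, abs_of_pos hα]
  have hm' : ∀ k, ∃ m, |a k| ≠ 1 → k ≠ m ∧ a m ≠ 0 := fun k => by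
    by_cases hk : |a k| = 1
    · exact ⟨k, fun h => absurd hk h⟩
    · obtain ⟨m, hm⟩ := exists_ne_zero_of_abs_ne_one ha hk
      exact ⟨m, fun _ => hm⟩
  choose m hm using hm'
  have htop : ∀ k, μHE[2 * (n - 2)] (firstFaceSection discRadius a k (discRadius : ℂ)) ≠ ⊤ :=
    fun k => by simpa using measure_firstFaceSection_ne_top (k := k) ha hα hu
  have hsum := sum_measure_firstFaceSection ha hα hu m hm
  simp only [Complex.finrank_real_complex, Fintype.card_fin] at hsum
  -- The factor 1/2 reduces 2/a_m² to 1/a_m²; the Jacobian is squared here because ℂ has real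
  -- dimension 2.
  refine ⟨fun k => 2 / a (m k) ^ 2 * slabMeasure discRadius a k (m k) (discRadius : ℂ),
    fun k hk => hasImproperIntegral_jOne (hm k hk).1 (hm k hk).2, ?_, ?_⟩
  · rw [complexPerimeter_eq]
    exact ENNReal.mul_ne_top ENNReal.ofReal_ne_top (ENNReal.sum_ne_top.2 fun k _ => htop k)
  · rw [complexPerimeter_eq, ENNReal.toReal_mul, ENNReal.toReal_sum fun k _ => htop k,
      ENNReal.toReal_ofReal (by positivity)]
    congr 1
    refine hsum.trans (Finset.sum_congr rfl fun k _ => ?_)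
    have hle : 0 ≤ 1 - a k ^ 2 := by
      rw [← ha, sub_nonneg]
      exact Finset.single_le_sum (f := fun i => a i ^ 2) (fun _ _ => sq_nonneg _) (Finset.mem_univ k)
    split_ifs with hk
    · rw [← sq_abs (a k), hk]; simp
    · have h1 := (hm k hk).2
      rw [div_pow, Real.sq_sqrt hle, sq_abs]
      field_simp

end Boundary

theorem proposition2 (n : ℕ) (hn : 2 ≤ n) (a : EuclideanSpace ℝ (Fin n)) (ha : ‖a‖ = 1) :
    (∃ I : Fin n → ℝ,
      (∀ k, |a k| ≠ 1 →
        HasImproperIntegral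
          (fun s => (∏ j ∈ Finset.univ.erase k, Real.sinc (a j * s)) * Real.cos (a k * s)) (I k)) ∧
      realPerimeter a ≠ ⊤ ∧
      (realPerimeter a).toReal =
        2 * ∑ k, Real.sqrt (1 - a k ^ 2) * (2 / Real.pi * I k)) ∧
    (∃ I : Fin n → ℝ,
      (∀ k, |a k| ≠ 1 →
        HasImproperIntegral
          (fun s => (∏ j ∈ Finset.univ.erase k, jOne (a j * s)) * besselJ 0 (a k * s) * s) (I k)) ∧
      complexPerimeter (toComplexVector a) ≠ ⊤ ∧
      (complexPerimeter (toComplexVector a)).toReal =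
        2 * Real.pi * ∑ k, (1 - a k ^ 2) * (1 / 2 * I k)) := by
  have hsum : ∑ i, a i ^ 2 = 1 := by
    have h := EuclideanSpace.real_norm_sq_eq a
    rw [ha] at h
    simpa using h.symm
  exact ⟨real_perimeter_formula a hsum, complex_perimeter_formula a hsum⟩
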